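/- Let $f=(f^1,f^2)$ be a smooth $\mathbb R^2$-valued function of $(x,y)=(x^1,x^2,y^1,y^2)\in\mathbb R^4$ with $\det(\partial f^i/\partial x^j)\neq0$, $\det(\partial f^i/\partial y^j)\ne0$ on an open set. The foliations $x=\mathrm{const}$, $y=\mathrm{const}$, $f=\mathrm{const}$ form a three-web $W(3,2,2)$ there. Put $\omega_1^i=\frac{\partial f^i}{\partial x^j}dx^j$, $\omega_2^i=\frac{\partial f^i}{\partial y^j}dy^j$ and $$\Gamma^i_{jk}=-\frac{\partial^2f^i}{\partial x^l\partial y^m}\,\bar g^l_j\,\tilde g^m_k,\qquad \omega^i_j=\Gamma^i_{kj}\omega_1^k+\Gamma^i_{jk}\omega_2^k ,$$ where $\bar g,\tilde g$ are the inverses of the matrices $(\partial f^i/\partial x^j)$, $(\partial f^i/\partial y^j)$. The covector $a=(a_1,a_2)$, the quantities $p_{ij},q_{ij},p,q$ and the curvature tensor $b^i_{jkl}$ are determined by $$\Gamma^i_{[jk]}=a_{[j}\delta^i_{k]},\quad \nabla a_i:=da_i-a_j\omega_i^j=p_{ij}\omega_1^j+q_{ij}\omega_2^j,\quad p=p_{[12]},\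 q=q_{[12]},\quad d\omega^i_j-\omega_j^m\wedge\omega_m^i=b^i_{jkl}\,\omega_1^k\wedge\omega_2^l .$$ A field of subspaces of the tangent spaces is integrable as a $k$-dimensional distribution on $U$ if through every point of $U$ passes a smooth $k$-dimensional submanifold of $U$ whose tangent space at each of its points is the given subspace. Consider the following classes of webs on $U$ (conditions on functions are required at every point of $U$). * $\mathbf{G_3}$: $p=q\neq0$. * $\mathbf{E_{111}}$: $a_1\ne0$, $a_2\neq0$, $a_1\ne a_2$; $p_{i2}=q_{i1}=0$ for $i=1,2$; and $p_{21}=-q_{12}$. * $\mathbf B$: the transversal distribution $a_1\omega_1^1+a_2\omega_1^2=0,\ a_1\omega_2^1+a_2\omega_2^2=0$ is not integrable as a 2-dimensional distribution on $U$, and the conditions $a_2^2p_{11}-2a_1a_2p_{(12)}+a_1^2p_{22}=0$, $a_2^2q_{11}-2a_1a_2q_{(12)}+a_1^2q_{22}=0$ do not both hold throughout $U$. * $\mathbf C$: the web is not transversally geodesic on $U$, i.e. it is not true that for every point of $U$ and every $\xi\ne0$ the plane $\xi^2\omega_1^1-\xi^1\omega_1^2=0,\ \xi^2\omega_2^1-\xi^1\omega_2^2=0$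 at this point is tangent to a smooth surface in $U$ all of whose tangent planes are of this form (with varying $\xi\neq 0$); and it is not true that at every point of $U$ one has $b^i_{(jkl)}=\delta^i_{(j}b_{kl)}$ for some $b_{kl}$. **Statement.** Let $$f^1=x^1+y^1+\tfrac12(x^1)^2y^2,\qquad f^2=x^2+y^2+\tfrac12x^1(y^2)^2,$$ and let $U\subset\mathbb R^4$ be any nonempty open set on which $1+x^1y^2\neq0$. Then these functions define a three-web on $U$, and: 1. If $a\neq0$ at every point of $U$, then the condition $p_{21}=-q_{12}$ on $U$ is necessary and sufficient for the distribution $a_1\omega_1^1-a_2\omega_2^2=0$ to be integrable (as a 3-dimensional distribution) on $U$. Moreover, on $U$ (without this restriction), $d(a_1\omega_1^1-a_2\omega_2^2)=\nabla a_1\wedge\omega_1^1-\nabla a_2\wedge\omega_2^2$, and at each point $\nabla a_1\wedge\omega_1^1=\nabla a_2\wedge\omega_2^2$ if and only if $p_{21}=-q_{12}$. 2. The 3-dimensional distributions $\omega_1^i+\omega_2^i=0$, $i=1,2$, are integrable on $U$. 3. At every point of $U$: $p=q$, $p_{i2}=q_{i1}=0$ for $i=1,2$, and $p_{21}=-q_{12}$.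 The web belongs to $\mathbf{G_3}$ on $U$ if and only if $x^1y^2\neq1$ on $U$; it belongs to $\mathbf{E_{111}}$ on $U$ if and only if $x^1\neq0$, $y^2\neq0$ and $x^1\neq-y^2$ on $U$; it belongs to $\mathbf B$ and $\mathbf C$ on $U$. The set of points of $\mathbb R^4$ with $1+x^1y^2\ne0$, $x^1y^2\neq1$, $x^1\neq0$, $y^2\neq0$, $x^1\neq-y^2$ is dense, so the web lies in $\mathbf{G_3}$, $\mathbf{E_{111}}$, $\mathbf B$ and $\mathbf C$ on a dense open subset of $\mathbb R^4$. -/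

import Mathlib

open scoped ContDiff

/-!
Four-dimensional three-webs of codimension two on open sets of `ℝ² × ℝ²`, given by the foliations
`x = const`, `y = const`, `f (x, y) = const`.  A point is `P = (x, y)`, with `xⁱ = P.1 i`,
`yⁱ = P.2 i`; the indices `1, 2` of the mathematics are `0, 1 : Fin 2`.
-/

namespace ThreeWeb

/-- The ambient space `ℝ² × ℝ²` of the coordinates `(x¹, x², y¹, y²)`. -/
abbrev Space : Type := (Fin 2 → ℝ) × (Fin 2 → ℝ)

/-- One-forms on `ℝ² × ℝ²`. -/
abbrev OneForm : Type := Space → Space →L[ℝ] ℝ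

/-- The coordinate form `dxʲ`. -/
noncomputable def dx (j : Fin 2) : Space →L[ℝ] ℝ :=
  (ContinuousLinearMap.proj j : (Fin 2 → ℝ) →L[ℝ] ℝ).comp
    (ContinuousLinearMap.fst ℝ (Fin 2 → ℝ) (Fin 2 → ℝ))

/-- The coordinate form `dyʲ`. -/
noncomputable def dy (j : Fin 2) : Space →L[ℝ] ℝ :=
  (ContinuousLinearMap.proj j : (Fin 2 → ℝ) →L[ℝ] ℝ).comp
    (ContinuousLinearMap.snd ℝ (Fin 2 → ℝ) (Fin 2 → ℝ))

/-- `∂g/∂xʲ`. -/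
noncomputable def ddx (j : Fin 2) (g : Space → ℝ) (P : Space) : ℝ :=
  fderiv ℝ g P (Pi.single j 1, 0)

/-- `∂g/∂yʲ`. -/
noncomputable def ddy (j : Fin 2) (g : Space → ℝ) (P : Space) : ℝ :=
  fderiv ℝ g P (0, Pi.single j 1)

/-- The exterior derivative of a one-form, as a function of two vectors. -/
noncomputable def extD (θ : OneForm) (P u v : Space) : ℝ :=
  fderiv ℝ θ P u v - fderiv ℝ θ P v u

/-- The exterior product of two covectors, as a function of two vectors. -/
def wedge (α β : Space →L[ℝ] ℝ) (u v : Space) : ℝ := α u * β v - α v * β u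

section Web

variable (f : Space → Fin 2 → ℝ)

/-- The matrix `∂fⁱ/∂xʲ`. -/
noncomputable def fBar (P : Space) : Matrix (Fin 2) (Fin 2) ℝ :=
  Matrix.of fun i j => ddx j (fun Q => f Q i) P

/-- The matrix `∂fⁱ/∂yʲ`. -/
noncomputable def fTilde (P : Space) : Matrix (Fin 2) (Fin 2) ℝ :=
  Matrix.of fun i j => ddy j (fun Q => f Q i) P

/-- The foliations `x = const`, `y = const`, `f (x, y) = const` form a (smooth) three-web on the
open set `U`: the leaves through each point are pairwise transversal. -/
def IsThreeWeb (U : Set Space) : Prop :=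
  IsOpen U ∧ ContDiffOn ℝ ∞ f U ∧ ∀ P ∈ U, (fBar f P).det ≠ 0 ∧ (fTilde f P).det ≠ 0

/-- The form `ωⁱ` of the first foliation, `(∂fⁱ/∂xʲ) dxʲ`. -/
noncomputable def om1 (i : Fin 2) : OneForm := fun P => ∑ j, fBar f P i j • dx j

/-- The form `ωⁱ` of the second foliation, `(∂fⁱ/∂yʲ) dyʲ`. -/
noncomputable def om2 (i : Fin 2) : OneForm := fun P => ∑ j, fTilde f P i j • dy j

/-- The frame vector dual to the first form of index `j`: it is killed by both second forms. -/
noncomputable def frame1 (j : Fin 2) (P : Space) : Space := (fun m => (fBar f P)⁻¹ m j, 0)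

/-- The frame vector dual to the second form of index `j`: it is killed by both first forms. -/
noncomputable def frame2 (j : Fin 2) (P : Space) : Space := (0, fun m => (fTilde f P)⁻¹ m j)

/-- `Γⁱⱼₖ`, the coefficients in `dω₁ⁱ = - dω₂ⁱ = Γⁱⱼₖ ω₁ʲ ∧ ω₂ᵏ`. -/
noncomputable def Gam (i j k : Fin 2) (P : Space) : ℝ :=
  -∑ l, ∑ m, ddx l (ddy m (fun Q => f Q i)) P * (fBar f P)⁻¹ l j * (fTilde f P)⁻¹ m k

/-- The connection form with lower index `j` and upper index `i`:
`ωⱼⁱ = Γⁱₖⱼ ω₁ᵏ + Γⁱⱼₖ ω₂ᵏ`. -/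
noncomputable def conn (j i : Fin 2) : OneForm := fun P =>
  ∑ k, (Gam f i k j P • om1 f k P + Gam f i j k P • om2 f k P)

/-- The torsion tensor `aⁱⱼₖ = Γⁱ_[jk]`. -/
noncomputable def torsion (i j k : Fin 2) (P : Space) : ℝ :=
  (Gam f i j k P - Gam f i k j P) / 2

/-- The covector `a` of the web; it is determined by `torsion_eq` below. -/
noncomputable def covec (j : Fin 2) (P : Space) : ℝ := 2 * ∑ i, torsion f i j i P

/-- `aⁱⱼₖ = a_[j δⁱ_k]`. -/
theorem torsion_eq (i j k : Fin 2) (P : Space) :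
    torsion f i j k P =
      (covec f j P * (if i = k then 1 else 0) - covec f k P * (if i = j then 1 else 0)) / 2 := by
  fin_cases i <;> fin_cases j <;> fin_cases k <;>
    simp [covec, torsion, Fin.sum_univ_two] <;> ring

/-- The covariant differential `∇aᵢ = daᵢ - aⱼ ωᵢʲ`. -/
noncomputable def nablaA (i : Fin 2) : OneForm := fun P =>
  fderiv ℝ (covec f i) P - ∑ j, covec f j P • conn f i j P

/-- `pᵢⱼ`, from `∇aᵢ = pᵢⱼ ω₁ʲ + qᵢⱼ ω₂ʲ`. -/
noncomputable def pT (i j : Fin 2) (P : Space) : ℝ := nablaA f i P (frame1 f j P)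

/-- `qᵢⱼ`, from `∇aᵢ = pᵢⱼ ω₁ʲ + qᵢⱼ ω₂ʲ`. -/
noncomputable def qT (i j : Fin 2) (P : Space) : ℝ := nablaA f i P (frame2 f j P)

/-- `p = p_[12]`. -/
noncomputable def pAlt (P : Space) : ℝ := (pT f 0 1 P - pT f 1 0 P) / 2

/-- `q = q_[12]`. -/
noncomputable def qAlt (P : Space) : ℝ := (qT f 0 1 P - qT f 1 0 P) / 2

/-- The curvature tensor `bⁱⱼₖₗ`, from `dωⱼⁱ - ωⱼᵐ ∧ ωₘⁱ = bⁱⱼₖₗ ω₁ᵏ ∧ ω₂ˡ`. -/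
noncomputable def curv (i j k l : Fin 2) (P : Space) : ℝ :=
  extD (conn f j i) P (frame1 f k P) (frame2 f l P) -
    ∑ m, wedge (conn f j m P) (conn f m i P) (frame1 f k P) (frame2 f l P)

end Web

/-- Symmetrization `T_(jkl)` of a quantity with three indices. -/
noncomputable def sym3 (T : Fin 2 → Fin 2 → Fin 2 → ℝ) (j k l : Fin 2) : ℝ :=
  (T j k l + T j l k + T k j l + T k l j + T l j k + T l k j) / 6

/-- A field `D` of subspaces is integrable on `U` as a `k`-dimensional distribution: through each
point of `U` passes a smooth `k`-dimensional integral submanifold (given by a local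
parametrization) whose tangent space at each of its points is the subspace there. -/
def IsIntegrable (k : ℕ) (D : Space → Submodule ℝ Space) (U : Set Space) : Prop :=
  ∀ P ∈ U, ∃ (W : Set (Fin k → ℝ)) (φ : (Fin k → ℝ) → Space),
    IsOpen W ∧ (0 : Fin k → ℝ) ∈ W ∧ φ 0 = P ∧ Set.MapsTo φ W U ∧ ContDiffOn ℝ ∞ φ W ∧
    ∀ w ∈ W, Function.Injective (fderiv ℝ φ w) ∧
      LinearMap.range (fderiv ℝ φ w).toLinearMap = D (φ w)

section Classes

variable (f : Space → Fin 2 → ℝ)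

/-- The distribution `a₁ ω₁¹ + a₂ ω₁² = 0`, `a₁ ω₂¹ + a₂ ω₂² = 0`
(the transversal `a`-distribution). -/
noncomputable def transversalDist (P : Space) : Submodule ℝ Space :=
  LinearMap.ker (covec f 0 P • om1 f 0 P + covec f 1 P • om1 f 1 P).toLinearMap ⊓
    LinearMap.ker (covec f 0 P • om2 f 0 P + covec f 1 P • om2 f 1 P).toLinearMap

/-- The form `a₁ ω₁¹ - a₂ ω₂²`. -/
noncomputable def thetaForm : OneForm := fun P =>
  covec f 0 P • om1 f 0 P - covec f 1 P • om2 f 1 P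

/-- The distribution `a₁ ω₁¹ - a₂ ω₂² = 0`. -/
noncomputable def thetaDist (P : Space) : Submodule ℝ Space :=
  LinearMap.ker (thetaForm f P).toLinearMap

/-- The distribution `ω₁ⁱ + ω₂ⁱ = 0`. -/
noncomputable def sumDist (i : Fin 2) (P : Space) : Submodule ℝ Space :=
  LinearMap.ker (om1 f i P + om2 f i P).toLinearMap

/-- The pair of algebraic conditions expressing integrability of the transversal
`a`-distribution through `a`, `p`, `q`. -/
def TransversalCondition (P : Space) : Prop :=
  covec f 1 P ^ 2 * pT f 0 0 P
      - 2 * covec f 0 P * covec f 1 P * ((pT f 0 1 P + pT f 1 0 P) / 2)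
      + covec f 0 P ^ 2 * pT f 1 1 P = 0 ∧
  covec f 1 P ^ 2 * qT f 0 0 P
      - 2 * covec f 0 P * covec f 1 P * ((qT f 0 1 P + qT f 1 0 P) / 2)
      + covec f 0 P ^ 2 * qT f 1 1 P = 0

/-- The transversal plane `ξ² ω₁¹ - ξ¹ ω₁² = 0`, `ξ² ω₂¹ - ξ¹ ω₂² = 0` at `P`. -/
noncomputable def transversalPlane (ξ : Fin 2 → ℝ) (P : Space) : Submodule ℝ Space :=
  LinearMap.ker (ξ 1 • om1 f 0 P - ξ 0 • om1 f 1 P).toLinearMap ⊓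
    LinearMap.ker (ξ 1 • om2 f 0 P - ξ 0 • om2 f 1 P).toLinearMap

/-- The web is transversally geodesic on `U`: every transversal plane at every point is tangent
to a smooth surface all of whose tangent planes are transversal. -/
def IsTransversallyGeodesic (U : Set Space) : Prop :=
  ∀ P ∈ U, ∀ ξ : Fin 2 → ℝ, ξ ≠ 0 → ∃ (W : Set (Fin 2 → ℝ)) (φ : (Fin 2 → ℝ) → Space),
    IsOpen W ∧ (0 : Fin 2 → ℝ) ∈ W ∧ φ 0 = P ∧ Set.MapsTo φ W U ∧ ContDiffOn ℝ ∞ φ W ∧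
    LinearMap.range (fderiv ℝ φ 0).toLinearMap = transversalPlane f ξ P ∧
    ∀ w ∈ W, Function.Injective (fderiv ℝ φ w) ∧
      ∃ η : Fin 2 → ℝ, η ≠ 0 ∧
        LinearMap.range (fderiv ℝ φ w).toLinearMap = transversalPlane f η (φ w)

/-- The condition `bⁱ_(jkl) = δⁱ_(j b_kl)` on the curvature tensor at `P`. -/
def CurvatureCondition (P : Space) : Prop :=
  ∃ B : Fin 2 → Fin 2 → ℝ, ∀ i j k l : Fin 2,
    sym3 (fun j k l => curv f i j k l P) j k l =
      sym3 (fun j k l => (if i = j then 1 else 0) * B k l) j k l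

/-- Class **B**: the transversal `a`-distribution is not integrable; both the geometric
condition and the algebraic one fail. -/
def InClassB (U : Set Space) : Prop :=
  ¬ IsIntegrable 2 (transversalDist f) U ∧ ¬ ∀ P ∈ U, TransversalCondition f P

/-- Class **C**: the web is not transversally geodesic; both the geometric condition and the
algebraic one fail. -/
def InClassC (U : Set Space) : Prop :=
  ¬ IsTransversallyGeodesic f U ∧ ¬ ∀ P ∈ U, CurvatureCondition f P

/-- Class **E₁**. -/
def InClassE1 (U : Set Space) : Prop :=
  ∀ P ∈ U, covec f 0 P ≠ 0 ∧ covec f 1 P ≠ 0 ∧ covec f 0 P ≠ covec f 1 P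

/-- Class **E₁₁**, a subclass of **E₁**. -/
def InClassE11 (U : Set Space) : Prop :=
  InClassE1 f U ∧ ∀ P ∈ U, ∀ i, pT f i 1 P = 0 ∧ qT f i 0 P = 0

/-- Class **E₁₁₁**, a subclass of **E₁₁**. -/
def InClassE111 (U : Set Space) : Prop :=
  InClassE11 f U ∧ ∀ P ∈ U, pT f 1 0 P = -qT f 0 1 P

/-- Class **G₃**: `p = q ≠ 0`. -/
def InClassG3 (U : Set Space) : Prop :=
  ∀ P ∈ U, pAlt f P = qAlt f P ∧ pAlt f P ≠ 0

end Classes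

/-- The functions `u₃¹ = x¹ + y¹ + ½ (x¹)² y²`, `u₃² = x² + y² + ½ x¹ (y²)²`. -/
noncomputable def webMap (P : Space) : Fin 2 → ℝ :=
  ![P.1 0 + P.2 0 + (1 / 2) * P.1 0 ^ 2 * P.2 1, P.1 1 + P.2 1 + (1 / 2) * P.1 0 * P.2 1 ^ 2]

end ThreeWeb

open ThreeWeb

/-!
A one-form vanishing on an integrable distribution pulls back to zero on every integral manifold,
so its exterior derivative vanishes on the distribution too. For the forms `∑ aᵢ ω₁ⁱ`, `∑ aᵢ ω₂ⁱ`
of the transversal distribution this is the algebraic condition of class **B**.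

On a transversal surface the first structure equations say that the covariant derivative of the
direction `η` of its tangent planes is proportional to `η`. Differentiating once more (the Ricci
identity), the curvature `bⁱⱼₖₗ ηʲ ηᵏ ηˡ` is proportional to `ηⁱ`; for a transversally geodesic
web this holds for every `η`, and comparing the coefficients of this polynomial identity gives the
algebraic condition of class **C**.

For the explicit web all tensors are rational functions of `x¹` and `y²`; the first condition
fails wherever `x¹ y² ≠ 0`, the second one everywhere. Moreover
`a₁ ω₁¹ - a₂ ω₂² = -d log (1 + x¹ y²)` and `ω₁ⁱ + ω₂ⁱ = dfⁱ` are exact, so the corresponding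
distributions are tangent to level sets. The exceptional points are the zeros of a nonzero
polynomial, hence nowhere dense.
-/

namespace ThreeWeb

open Filter Topology Module

open scoped Matrix

section ExteriorCalculus

variable {E F : Type*} [NormedAddCommGroup E] [NormedSpace ℝ E]
  [NormedAddCommGroup F] [NormedSpace ℝ F]

/-- The exterior derivative of a one-form on a normed space, as a function of two vectors.
For forms on `Space` it is definitionally `extD`; the general version is needed for forms pulled
back to the parameter domain of an integral submanifold. -/
noncomputable def extDeriv₁ (θ : E → E →L[ℝ] ℝ) (x u v : E) : ℝ :=
  fderiv ℝ θ x u v - fderiv ℝ θ x v u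

theorem extDeriv₁_congr {θ θ' : E → E →L[ℝ] ℝ} {x : E} (h : θ =ᶠ[𝓝 x] θ') :
    extDeriv₁ θ x = extDeriv₁ θ' x := by
  unfold extDeriv₁
  rw [h.fderiv_eq]

theorem extDeriv₁_const (c : E →L[ℝ] ℝ) (x u v : E) : extDeriv₁ (fun _ => c) x u v = 0 := by
  simp [extDeriv₁]

theorem extDeriv₁_add {θ θ' : E → E →L[ℝ] ℝ} {x : E} (h : DifferentiableAt ℝ θ x)
    (h' : DifferentiableAt ℝ θ' x) (u v : E) :
    extDeriv₁ (fun y => θ y + θ' y) x u v = extDeriv₁ θ x u v + extDeriv₁ θ' x u v := by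
  rw [extDeriv₁, fderiv_fun_add h h', extDeriv₁, extDeriv₁]
  simp only [add_apply]
  ring

theorem extDeriv₁_sum {ι : Type*} (s : Finset ι) {θ : ι → E → E →L[ℝ] ℝ} {x : E}
    (h : ∀ i ∈ s, DifferentiableAt ℝ (θ i) x) (u v : E) :
    extDeriv₁ (fun y => ∑ i ∈ s, θ i y) x u v = ∑ i ∈ s, extDeriv₁ (θ i) x u v := by
  simp only [extDeriv₁, fderiv_fun_sum h, sum_apply, Finset.sum_sub_distrib]

theorem extDeriv₁_smul {g : E → ℝ} {θ : E → E →L[ℝ] ℝ} {x : E} (hg : DifferentiableAt ℝ g x)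
    (h : DifferentiableAt ℝ θ x) (u v : E) :
    extDeriv₁ (fun y => g y • θ y) x u v =
      fderiv ℝ g x u * θ x v - fderiv ℝ g x v * θ x u + g x * extDeriv₁ θ x u v := by
  rw [extDeriv₁, fderiv_fun_smul hg h, extDeriv₁]
  simp
  ring

theorem extDeriv₁_sum_smul_const {ι : Type*} (s : Finset ι) {g : ι → E → ℝ} (c : ι → E →L[ℝ] ℝ)
    {x : E} (hg : ∀ i ∈ s, DifferentiableAt ℝ (g i) x) (u v : E) :
    extDeriv₁ (fun y => ∑ i ∈ s, g i y • c i) x u v =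
      ∑ i ∈ s, (fderiv ℝ (g i) x u * c i v - fderiv ℝ (g i) x v * c i u) := by
  rw [extDeriv₁_sum s (θ := fun i y => g i y • c i)
    fun i hi => (hg i hi).smul (differentiableAt_const _)]
  refine Finset.sum_congr rfl fun i hi => ?_
  rw [extDeriv₁_smul (hg i hi) (differentiableAt_const _), extDeriv₁_const, mul_zero, add_zero]

theorem extDeriv₁_fderiv {g : E → ℝ} {x : E} (hg : ContDiffAt ℝ 2 g x) (u v : E) :
    extDeriv₁ (fderiv ℝ g) x u v = 0 := by
  have hsymm : IsSymmSndFDerivAt ℝ g x :=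
    hg.isSymmSndFDerivAt (by rw [minSmoothness_of_isRCLikeNormedField])
  exact sub_eq_zero.2 (hsymm u v)

/-- The pullback of a one-form under a map of normed spaces. -/
noncomputable def pullback (φ : E → F) (θ : F → F →L[ℝ] ℝ) (x : E) : E →L[ℝ] ℝ :=
  (θ (φ x)).comp (fderiv ℝ φ x)

theorem pullback_apply (φ : E → F) (θ : F → F →L[ℝ] ℝ) (x u : E) :
    pullback φ θ x u = θ (φ x) (fderiv ℝ φ x u) := rfl

theorem contDiffAt_pullback {φ : E → F} {θ : F → F →L[ℝ] ℝ} {x : E}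
    (hφ : ContDiffAt ℝ ∞ φ x) (hθ : ContDiffAt ℝ ∞ θ (φ x)) :
    ContDiffAt ℝ ∞ (pullback φ θ) x :=
  (hθ.comp x hφ).clm_comp (hφ.fderiv_right (by simp))

theorem extDeriv₁_pullback {φ : E → F} {θ : F → F →L[ℝ] ℝ} {x : E}
    (hφ : ContDiffAt ℝ 2 φ x) (hθ : DifferentiableAt ℝ θ (φ x)) (u v : E) :
    extDeriv₁ (pullback φ θ) x u v =
      extDeriv₁ θ (φ x) (fderiv ℝ φ x u) (fderiv ℝ φ x v) := by
  have hsymm : fderiv ℝ (fderiv ℝ φ) x u v = fderiv ℝ (fderiv ℝ φ) x v u :=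
    hφ.isSymmSndFDerivAt (by rw [minSmoothness_of_isRCLikeNormedField]) u v
  have hφ₁ : DifferentiableAt ℝ φ x := hφ.differentiableAt (by simp)
  have hφ₂ : DifferentiableAt ℝ (fderiv ℝ φ) x :=
    (hφ.fderiv_right (m := 1) (by norm_num)).differentiableAt (by simp)
  have hcomp : HasFDerivAt (fun y => θ (φ y)) ((fderiv ℝ θ (φ x)).comp (fderiv ℝ φ x)) x :=
    hθ.hasFDerivAt.comp x hφ₁.hasFDerivAt
  have hpull : HasFDerivAt (pullback φ θ) _ x := hcomp.clm_comp hφ₂.hasFDerivAt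
  rw [extDeriv₁, hpull.fderiv, extDeriv₁]
  simp [hsymm]

end ExteriorCalculus

section Integrability

variable {k : ℕ} {D : Space → Submodule ℝ Space} {U : Set Space}

/-- The easy half of Frobenius' theorem: a form that vanishes on `D` pulls back to zero on every
integral submanifold of `D`. -/
theorem IsIntegrable.extD_eq_zero (hD : IsIntegrable k D U) {θ : OneForm}
    (hθ : ∀ P ∈ U, ∀ v ∈ D P, θ P v = 0) {P : Space} (hP : P ∈ U) (hθP : DifferentiableAt ℝ θ P)
    {u v : Space} (hu : u ∈ D P) (hv : v ∈ D P) : extD θ P u v = 0 := by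
  obtain ⟨W, φ, hW, h0, rfl, hWU, hφ, hrange⟩ := hD P hP
  have mem_D {w} (hw : w ∈ W) (z) : fderiv ℝ φ w z ∈ D (φ w) := (hrange w hw).2 ▸ ⟨z, rfl⟩
  obtain ⟨u, rfl⟩ := (hrange 0 h0).2.symm ▸ hu
  obtain ⟨v, rfl⟩ := (hrange 0 h0).2.symm ▸ hv
  have pullback_eq : pullback φ θ =ᶠ[𝓝 0] fun _ => 0 := by
    filter_upwards [hW.mem_nhds h0] with w hw
    ext z
    exact hθ _ (hWU hw) _ (mem_D hw z)
  have hφ2 : ContDiffAt ℝ 2 φ 0 := (hφ.contDiffAt (hW.mem_nhds h0)).of_le (by norm_cast)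
  calc extD θ (φ 0) (fderiv ℝ φ 0 u) (fderiv ℝ φ 0 v)
      = extDeriv₁ (pullback φ θ) 0 u v :=
        (extDeriv₁_pullback hφ2 hθP u v).symm
    _ = 0 := by rw [extDeriv₁_congr pullback_eq, extDeriv₁_const]

end Integrability

section LevelSets

variable {E G : Type*} [NormedAddCommGroup E] [NormedSpace ℝ E]
  [NormedAddCommGroup G] [NormedSpace ℝ G]

theorem exists_contDiffOn_rightInverse [CompleteSpace E] {Ψ : E → G} {U : Set E} (hU : IsOpen U)
    (hΨ : ContDiffOn ℝ ∞ Ψ U) {x : E} (hx : x ∈ U) (hΨx : (fderiv ℝ Ψ x).IsInvertible) :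
    ∃ (V : Set G) (σ : G → E), IsOpen V ∧ Ψ x ∈ V ∧ ContDiffOn ℝ ∞ σ V ∧ Set.MapsTo σ V U ∧
      (∀ y ∈ V, Ψ (σ y) = y) ∧ σ (Ψ x) = x := by
  have smooth {z} (hz : z ∈ U) : ContDiffAt ℝ ∞ Ψ z := hΨ.contDiffAt (hU.mem_nhds hz)
  have hasFDerivAt {z} (hz : z ∈ U) : HasFDerivAt Ψ (fderiv ℝ Ψ z) z :=
    ((smooth hz).differentiableAt (by simp)).hasFDerivAt
  obtain ⟨e, he⟩ := hΨx
  let T := (smooth hx).toOpenPartialHomeomorph Ψ (he ▸ hasFDerivAt hx) (by simp)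
  have hxT : x ∈ T.source := (smooth hx).mem_toOpenPartialHomeomorph_source _ _
  let O : Set E := U ∩ fderiv ℝ Ψ ⁻¹' Set.range ((↑) : (E ≃L[ℝ] G) → E →L[ℝ] G)
  have hO : IsOpen O := (hΨ.continuousOn_fderiv_of_isOpen hU (by simp)).isOpen_inter_preimage hU
    ContinuousLinearEquiv.isOpen
  refine ⟨T.target ∩ T.symm ⁻¹' O, T.symm, T.isOpen_inter_preimage_symm hO,
    ⟨T.map_source hxT, ?_⟩, ?_, fun y hy => hy.2.1, fun y hy => T.right_inv hy.1, T.left_inv hxT⟩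
  · rw [Set.mem_preimage, ← show T x = Ψ x from rfl, T.left_inv hxT]
    exact ⟨hx, e, he⟩
  · rintro y ⟨hyT, hyU, e', he'⟩
    exact (T.contDiffAt_symm hyT (he' ▸ hasFDerivAt hyU) (smooth hyU)).contDiffWithinAt

theorem exists_isInvertible_prod [FiniteDimensional ℝ E] [FiniteDimensional ℝ G] {k : ℕ}
    {L : E →L[ℝ] G} (hL : Function.Surjective L) (hk : k + finrank ℝ G = finrank ℝ E) :
    ∃ π : E →L[ℝ] (Fin k → ℝ), (L.prod π).IsInvertible := by
  obtain ⟨p, hp⟩ := (LinearMap.ker L.toLinearMap).subtype.exists_leftInverse_of_injective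
    (Submodule.ker_subtype _)
  have rank_nullity := L.toLinearMap.finrank_range_add_finrank_ker
  rw [LinearMap.range_eq_top.2 hL, finrank_top] at rank_nullity
  let b : LinearMap.ker L.toLinearMap ≃ₗ[ℝ] (Fin k → ℝ) :=
    LinearEquiv.ofFinrankEq _ _ (by rw [finrank_fin_fun]; omega)
  let π : E →L[ℝ] (Fin k → ℝ) := (b.toLinearMap ∘ₗ p).toContinuousLinearMap
  have inj : Function.Injective (L.prod π).toLinearMap := by
    refine (injective_iff_map_eq_zero _).2 fun v hv => ?_
    obtain ⟨hLv, hπv⟩ := Prod.ext_iff.1 hv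
    have hpv : p v = ⟨v, hLv⟩ := LinearMap.congr_fun hp ⟨v, hLv⟩
    have hpv0 : p v = 0 := b.map_eq_zero_iff.1 hπv
    exact congrArg Subtype.val (hpv.symm.trans hpv0)
  let e : E ≃ₗ[ℝ] G × (Fin k → ℝ) := LinearEquiv.ofInjectiveOfFinrankEq _ inj
    (by rw [finrank_prod, finrank_fin_fun]; omega)
  exact ⟨π, e.toContinuousLinearEquiv, by ext <;> rfl⟩

theorem range_eq_ker_of_comp_eq_zero [FiniteDimensional ℝ E] [FiniteDimensional ℝ G] {k : ℕ}
    {L : E →L[ℝ] G} (hL : Function.Surjective L) (hk : k + finrank ℝ G = finrank ℝ E)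
    {A : (Fin k → ℝ) →L[ℝ] E} (hA : Function.Injective A) (hLA : L.comp A = 0) :
    LinearMap.range A.toLinearMap = LinearMap.ker L.toLinearMap := by
  have rank_nullity := L.toLinearMap.finrank_range_add_finrank_ker
  rw [LinearMap.range_eq_top.2 hL, finrank_top] at rank_nullity
  refine Submodule.eq_of_le_of_finrank_eq ?_ ?_
  · rintro _ ⟨z, rfl⟩
    exact DFunLike.congr_fun hLA z
  · rw [LinearMap.finrank_range_of_inj hA, finrank_fin_fun]
    omega

theorem isIntegrable_ker_fderiv [FiniteDimensional ℝ G] {k : ℕ} {U : Set Space} (hU : IsOpen U)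
    (hk : k + finrank ℝ G = finrank ℝ Space) {F : Space → G} (hF : ContDiffOn ℝ ∞ F U)
    (hF' : ∀ P ∈ U, Function.Surjective (fderiv ℝ F P)) :
    IsIntegrable k (fun P => LinearMap.ker (fderiv ℝ F P).toLinearMap) U := by
  intro P hP
  have hFdiff {Q} (hQ : Q ∈ U) : DifferentiableAt ℝ F Q :=
    (hF.contDiffAt (hU.mem_nhds hQ)).differentiableAt (by simp)
  obtain ⟨π, hπ⟩ := exists_isInvertible_prod (hF' P hP) hk
  have hΨ : fderiv ℝ (fun Q => (F Q, π Q)) P = (fderiv ℝ F P).prod π := by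
    rw [DifferentiableAt.fderiv_prodMk (hFdiff hP) π.differentiableAt, π.fderiv]
  obtain ⟨V, σ, hV, hPV, hσ, hσU, hσV, hσP⟩ :=
    exists_contDiffOn_rightInverse hU (hF.prodMk π.contDiff.contDiffOn) hP (hΨ ▸ hπ)
  let ι : (Fin k → ℝ) → G × (Fin k → ℝ) := fun w => (F P, π P + w)
  have hι : ContDiff ℝ ∞ ι := contDiff_const.prodMk (contDiff_const.add contDiff_id)
  refine ⟨ι ⁻¹' V, σ ∘ ι, hV.preimage hι.continuous, by simpa [ι] using hPV, by simp [ι, hσP],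
    fun w hw => hσU hw, hσ.comp hι.contDiffOn fun w hw => hw, fun w hw => ?_⟩
  have hφ : HasFDerivAt (σ ∘ ι) (fderiv ℝ (σ ∘ ι) w) w :=
    (((hσ.contDiffAt (hV.mem_nhds hw)).comp w hι.contDiffAt).differentiableAt
      (by simp)).hasFDerivAt
  have section_eq : (fun z => (F (σ (ι z)), π (σ (ι z)))) =ᶠ[𝓝 w] ι := by
    filter_upwards [(hV.preimage hι.continuous).mem_nhds hw] with z hz using hσV _ hz
  have dF_eq : (fderiv ℝ F (σ (ι w))).comp (fderiv ℝ (σ ∘ ι) w) = 0 :=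
    ((hFdiff (hσU hw)).hasFDerivAt.comp w hφ).unique <|
      (hasFDerivAt_const (F P) w).congr_of_eventuallyEq
        (section_eq.mono fun _ h => congrArg Prod.fst h)
  have dπ_eq : π.comp (fderiv ℝ (σ ∘ ι) w) = .id ℝ _ :=
    (π.hasFDerivAt.comp w hφ).unique <| ((hasFDerivAt_id w).const_add (π P)).congr_of_eventuallyEq
      (section_eq.mono fun _ h => congrArg Prod.snd h)
  have inj : Function.Injective (fderiv ℝ (σ ∘ ι) w) :=
    (show Function.LeftInverse π (fderiv ℝ (σ ∘ ι) w) from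
      DFunLike.congr_fun dπ_eq).injective
  exact ⟨inj, range_eq_ker_of_comp_eq_zero (hF' _ (hσU hw)) hk inj dF_eq⟩

theorem IsIntegrable.congr {k : ℕ} {D D' : Space → Submodule ℝ Space} {U : Set Space}
    (hD : IsIntegrable k D U) (h : ∀ P ∈ U, D P = D' P) : IsIntegrable k D' U := by
  intro P hP
  obtain ⟨W, φ, hW, h0, hφ0, hWU, hφ, hrange⟩ := hD P hP
  exact ⟨W, φ, hW, h0, hφ0, hWU, hφ, fun w hw =>
    ⟨(hrange w hw).1, (hrange w hw).2.trans (h _ (hWU hw))⟩⟩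

theorem isIntegrable_ker_of_hasFDerivAt {U : Set Space} (hU : IsOpen U) {g : Space → ℝ}
    (hg : ContDiffOn ℝ ∞ g U) {θ : OneForm} (hθ : ∀ P ∈ U, HasFDerivAt g (θ P) P)
    (hne : ∀ P ∈ U, θ P ≠ 0) : IsIntegrable 3 (fun P => LinearMap.ker (θ P).toLinearMap) U := by
  refine (isIntegrable_ker_fderiv hU (by simp) hg fun P hP => ?_).congr fun P hP => ?_
  · rw [(hθ P hP).fderiv]
    exact LinearMap.surjective (f := (θ P).toLinearMap)
      fun h0 => hne P hP (ContinuousLinearMap.coe_injective h0)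
  · rw [(hθ P hP).fderiv]

end LevelSets

section Coframe

variable {f : Space → Fin 2 → ℝ} {P : Space}

theorem dx_apply (j : Fin 2) (v : Space) : dx j v = v.1 j := rfl

theorem dy_apply (j : Fin 2) (v : Space) : dy j v = v.2 j := rfl

theorem fderiv_apply_eq_sum (g : Space → ℝ) (P v : Space) :
    fderiv ℝ g P v = ∑ j, (v.1 j * ddx j g P + v.2 j * ddy j g P) := by
  have hv : v = ∑ j, (v.1 j • ((Pi.single j 1, 0) : Space) +
      v.2 j • ((0, Pi.single j 1) : Space)) := by
    ext i <;> fin_cases i <;> simp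
  conv_lhs => rw [hv]
  simp only [map_sum, map_add, map_smul, smul_eq_mul, ddx, ddy]

theorem om1_apply (i : Fin 2) (v : Space) : om1 f i P v = (fBar f P *ᵥ v.1) i := by
  simp [om1, Matrix.mulVec, dotProduct, dx_apply]

theorem om2_apply (i : Fin 2) (v : Space) : om2 f i P v = (fTilde f P *ᵥ v.2) i := by
  simp [om2, Matrix.mulVec, dotProduct, dy_apply]

theorem om1_add_om2 (i : Fin 2) : om1 f i P + om2 f i P = fderiv ℝ (fun Q => f Q i) P := by
  ext v <;> simp [om1, om2, fderiv_apply_eq_sum, fBar, fTilde, dx_apply, dy_apply, mul_comm]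

/-- The vector tangent to the leaf `y = const` with components `ξ` in the frame `frame1`. -/
noncomputable def vec1 (f : Space → Fin 2 → ℝ) (ξ : Fin 2 → ℝ) (P : Space) : Space :=
  ((fBar f P)⁻¹ *ᵥ ξ, 0)

/-- The vector tangent to the leaf `x = const` with components `η` in the frame `frame2`. -/
noncomputable def vec2 (f : Space → Fin 2 → ℝ) (η : Fin 2 → ℝ) (P : Space) : Space :=
  (0, (fTilde f P)⁻¹ *ᵥ η)

theorem vec1_eq_sum (ξ : Fin 2 → ℝ) : vec1 f ξ P = ∑ j, ξ j • frame1 f j P := by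
  ext i <;> fin_cases i <;> simp [vec1, frame1, mul_comm]

theorem vec2_eq_sum (η : Fin 2 → ℝ) : vec2 f η P = ∑ j, η j • frame2 f j P := by
  ext i <;> fin_cases i <;> simp [vec2, frame2, mul_comm]

@[simp]
theorem om1_vec2 (i : Fin 2) (η : Fin 2 → ℝ) : om1 f i P (vec2 f η P) = 0 := by
  simp [om1_apply, vec2]

@[simp]
theorem om2_vec1 (i : Fin 2) (ξ : Fin 2 → ℝ) : om2 f i P (vec1 f ξ P) = 0 := by
  simp [om2_apply, vec1]

/-- The conditions for `f` to define a three-web near `P`. -/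
structure IsWebAt (f : Space → Fin 2 → ℝ) (P : Space) : Prop where
  contDiffAt : ContDiffAt ℝ ∞ f P
  det_fBar_ne_zero : (fBar f P).det ≠ 0
  det_fTilde_ne_zero : (fTilde f P).det ≠ 0

theorem IsThreeWeb.isWebAt {U : Set Space} (hw : IsThreeWeb f U) (hP : P ∈ U) : IsWebAt f P :=
  ⟨hw.2.1.contDiffAt (hw.1.mem_nhds hP), (hw.2.2 P hP).1, (hw.2.2 P hP).2⟩

namespace IsWebAt

variable (h : IsWebAt f P)
include h

theorem om1_vec1 (i : Fin 2) (ξ : Fin 2 → ℝ) : om1 f i P (vec1 f ξ P) = ξ i := by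
  rw [om1_apply, vec1, Matrix.mulVec_mulVec, Matrix.mul_nonsing_inv _ h.det_fBar_ne_zero.isUnit,
    Matrix.one_mulVec]

theorem om2_vec2 (i : Fin 2) (η : Fin 2 → ℝ) : om2 f i P (vec2 f η P) = η i := by
  rw [om2_apply, vec2, Matrix.mulVec_mulVec,
    Matrix.mul_nonsing_inv _ h.det_fTilde_ne_zero.isUnit, Matrix.one_mulVec]

theorem vec1_om1_add_vec2_om2 (v : Space) :
    vec1 f (fun i => om1 f i P v) P + vec2 f (fun i => om2 f i P v) P = v := by
  simp only [om1_apply, om2_apply, vec1, vec2, Matrix.mulVec_mulVec,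
    Matrix.nonsing_inv_mul _ h.det_fBar_ne_zero.isUnit,
    Matrix.nonsing_inv_mul _ h.det_fTilde_ne_zero.isUnit, Matrix.one_mulVec, Prod.mk_add_mk,
    add_zero, zero_add]

theorem conn_vec1 (i j : Fin 2) (ξ : Fin 2 → ℝ) :
    conn f j i P (vec1 f ξ P) = ∑ k, Gam f i k j P * ξ k := by
  simp [conn, h.om1_vec1]

theorem conn_vec2 (i j : Fin 2) (η : Fin 2 → ℝ) :
    conn f j i P (vec2 f η P) = ∑ k, Gam f i j k P * η k := by
  simp [conn, h.om2_vec2]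

theorem nablaA_eq_sum (i : Fin 2) :
    nablaA f i P = ∑ j, (pT f i j P • om1 f j P + qT f i j P • om2 f j P) := by
  refine ContinuousLinearMap.ext fun v => ?_
  conv_lhs => rw [← h.vec1_om1_add_vec2_om2 v, vec1_eq_sum, vec2_eq_sum]
  simp [pT, qT, mul_comm, Fin.sum_univ_two]
  ring

end IsWebAt

end Coframe

section Smoothness

variable {f : Space → Fin 2 → ℝ} {P : Space}

theorem contDiffAt_fderiv_apply {E : Type*} [NormedAddCommGroup E] [NormedSpace ℝ E] {g : E → ℝ}
    {x : E} (hg : ContDiffAt ℝ ∞ g x) (v : E) : ContDiffAt ℝ ∞ (fun y => fderiv ℝ g y v) x :=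
  (hg.fderiv_right (m := ∞) (by simp)).clm_apply contDiffAt_const

theorem contDiffAt_inv_entry {E ι : Type*} [NormedAddCommGroup E] [NormedSpace ℝ E] [Fintype ι]
    [DecidableEq ι] {n : WithTop ℕ∞} {M : E → Matrix ι ι ℝ} {x : E}
    (hM : ∀ i j, ContDiffAt ℝ n (fun y => M y i j) x) (hdet : (M x).det ≠ 0) (i j : ι) :
    ContDiffAt ℝ n (fun y => (M y)⁻¹ i j) x := by
  have contDiffAt_det {N : E → Matrix ι ι ℝ} (hN : ∀ i j, ContDiffAt ℝ n (fun y => N y i j) x) :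
      ContDiffAt ℝ n (fun y => (N y).det) x := by
    simp only [Matrix.det_apply']
    exact ContDiffAt.sum fun σ _ => contDiffAt_const.mul (contDiffAt_prod fun i _ => hN _ _)
  have contDiffAt_adjugate : ContDiffAt ℝ n (fun y => (M y).adjugate i j) x := by
    simp only [Matrix.adjugate_apply]
    refine contDiffAt_det fun k l => ?_
    by_cases hk : k = j
    · subst hk; simpa using contDiffAt_const
    · simpa [Matrix.updateRow_ne hk] using hM k l
  simp only [Matrix.inv_def, Ring.inverse_eq_inv', Matrix.smul_apply, smul_eq_mul]
  exact ((contDiffAt_det hM).inv hdet).mul contDiffAt_adjugate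

namespace IsWebAt

variable (h : IsWebAt f P)
include h

theorem contDiffAt_apply (i : Fin 2) : ContDiffAt ℝ ∞ (fun Q => f Q i) P :=
  contDiffAt_pi.1 h.contDiffAt i

theorem contDiffAt_fBar (i j : Fin 2) : ContDiffAt ℝ ∞ (fun Q => fBar f Q i j) P :=
  contDiffAt_fderiv_apply (h.contDiffAt_apply i) _

theorem contDiffAt_fTilde (i j : Fin 2) : ContDiffAt ℝ ∞ (fun Q => fTilde f Q i j) P :=
  contDiffAt_fderiv_apply (h.contDiffAt_apply i) _

theorem contDiffAt_om1 (i : Fin 2) : ContDiffAt ℝ ∞ (om1 f i) P :=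
  ContDiffAt.sum fun j _ => (h.contDiffAt_fBar i j).smul contDiffAt_const

theorem contDiffAt_om2 (i : Fin 2) : ContDiffAt ℝ ∞ (om2 f i) P :=
  ContDiffAt.sum fun j _ => (h.contDiffAt_fTilde i j).smul contDiffAt_const

theorem contDiffAt_Gam (i j k : Fin 2) : ContDiffAt ℝ ∞ (Gam f i j k) P :=
  (ContDiffAt.sum fun l _ => ContDiffAt.sum fun m _ =>
    ((contDiffAt_fderiv_apply (h.contDiffAt_fTilde i m) _).mul
      (contDiffAt_inv_entry h.contDiffAt_fBar h.det_fBar_ne_zero l j)).mul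
      (contDiffAt_inv_entry h.contDiffAt_fTilde h.det_fTilde_ne_zero m k)).neg

theorem contDiffAt_conn (j i : Fin 2) : ContDiffAt ℝ ∞ (conn f j i) P :=
  ContDiffAt.sum fun k _ => ((h.contDiffAt_Gam i k j).smul (h.contDiffAt_om1 k)).add
    ((h.contDiffAt_Gam i j k).smul (h.contDiffAt_om2 k))

theorem contDiffAt_covec (j : Fin 2) : ContDiffAt ℝ ∞ (covec f j) P :=
  contDiffAt_const.mul <| ContDiffAt.sum fun i _ =>
    ((h.contDiffAt_Gam i j i).sub (h.contDiffAt_Gam i i j)).div_const 2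

theorem differentiableAt_om1 (i : Fin 2) : DifferentiableAt ℝ (om1 f i) P :=
  (h.contDiffAt_om1 i).differentiableAt (by simp)

theorem differentiableAt_om2 (i : Fin 2) : DifferentiableAt ℝ (om2 f i) P :=
  (h.contDiffAt_om2 i).differentiableAt (by simp)

theorem differentiableAt_conn (j i : Fin 2) : DifferentiableAt ℝ (conn f j i) P :=
  (h.contDiffAt_conn j i).differentiableAt (by simp)

theorem differentiableAt_covec (j : Fin 2) : DifferentiableAt ℝ (covec f j) P :=
  (h.contDiffAt_covec j).differentiableAt (by simp)

end IsWebAt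

end Smoothness

section StructureEquations

variable {f : Space → Fin 2 → ℝ} {P : Space} (h : IsWebAt f P)
include h

theorem IsWebAt.extD_om1_add_extD_om2 (i : Fin 2) (u v : Space) :
    extD (om1 f i) P u v + extD (om2 f i) P u v = 0 := by
  have om_sum : (fun Q => om1 f i Q + om2 f i Q) = fderiv ℝ fun Q => f Q i :=
    funext fun _ => om1_add_om2 i
  calc extD (om1 f i) P u v + extD (om2 f i) P u v
      = extDeriv₁ (fun Q => om1 f i Q + om2 f i Q) P u v :=
        (extDeriv₁_add (h.differentiableAt_om1 i) (h.differentiableAt_om2 i) u v).symm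
    _ = 0 := by rw [om_sum, extDeriv₁_fderiv ((h.contDiffAt_apply i).of_le (by norm_cast))]

theorem IsWebAt.extD_om2_vec1_vec2 (i : Fin 2) (ξ η : Fin 2 → ℝ) :
    extD (om2 f i) P (vec1 f ξ P) (vec2 f η P) = -∑ j, ∑ k, Gam f i j k P * ξ j * η k := by
  have expand : extD (om2 f i) P (vec1 f ξ P) (vec2 f η P) =
      ∑ m, fderiv ℝ (fun Q => fTilde f Q i m) P (vec1 f ξ P) * (vec2 f η P).2 m := by
    refine (extDeriv₁_sum_smul_const _ dy (g := fun m Q => fTilde f Q i m) (fun m _ =>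
      (h.contDiffAt_fTilde i m).differentiableAt (by simp)) _ _).trans ?_
    simp [dy_apply, vec1]
  rw [expand]
  simp [fderiv_apply_eq_sum, vec1, vec2, Gam, fTilde]
  ring

theorem IsWebAt.extD_om1_vec1_vec2 (i : Fin 2) (ξ η : Fin 2 → ℝ) :
    extD (om1 f i) P (vec1 f ξ P) (vec2 f η P) = ∑ j, ∑ k, Gam f i j k P * ξ j * η k := by
  linear_combination h.extD_om1_add_extD_om2 i (vec1 f ξ P) (vec2 f η P) -
    h.extD_om2_vec1_vec2 i ξ η

end StructureEquations

section SumDist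

theorem IsThreeWeb.isIntegrable_sumDist {f : Space → Fin 2 → ℝ} {U : Set Space}
    (hw : IsThreeWeb f U) (i : Fin 2) : IsIntegrable 3 (sumDist f i) U := by
  refine isIntegrable_ker_of_hasFDerivAt hw.1 (g := fun Q => f Q i) (contDiffOn_pi.1 hw.2.1 i)
    (fun P hP => ?_) fun P hP h0 => ?_
  · rw [om1_add_om2]
    exact (((hw.isWebAt hP).contDiffAt_apply i).differentiableAt (by simp)).hasFDerivAt
  · have := DFunLike.congr_fun h0 (vec1 f (Pi.single i 1) P)
    simp [(hw.isWebAt hP).om1_vec1] at this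

end SumDist

section Covector

variable {f : Space → Fin 2 → ℝ} {P : Space} (h : IsWebAt f P)
include h

theorem IsWebAt.wedge_nablaA_eq_iff (hpq : ∀ i, pT f i 1 P = 0 ∧ qT f i 0 P = 0) :
    wedge (nablaA f 0 P) (om1 f 0 P) = wedge (nablaA f 1 P) (om2 f 1 P) ↔
      pT f 1 0 P = -qT f 0 1 P := by
  have nablaA_eq (i : Fin 2) : nablaA f i P = pT f i 0 P • om1 f 0 P + qT f i 1 P • om2 f 1 P := by
    rw [h.nablaA_eq_sum]
    simp [Fin.sum_univ_two, hpq i]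
  rw [nablaA_eq 0, nablaA_eq 1]
  constructor
  · intro heq
    have := congrFun₂ heq (vec1 f (Pi.single 0 1) P) (vec2 f (Pi.single 1 1) P)
    simp [wedge, h.om1_vec1, h.om2_vec2] at this
    linarith
  · intro hpq'
    funext u v
    simp [wedge, hpq']
    ring

theorem IsWebAt.nablaA_vec1 (i : Fin 2) (ξ : Fin 2 → ℝ) :
    nablaA f i P (vec1 f ξ P) = ∑ j, pT f i j P * ξ j := by
  simp [h.nablaA_eq_sum, h.om1_vec1]

theorem IsWebAt.nablaA_vec2 (i : Fin 2) (η : Fin 2 → ℝ) :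
    nablaA f i P (vec2 f η P) = ∑ j, qT f i j P * η j := by
  simp [h.nablaA_eq_sum, h.om2_vec2]

theorem IsWebAt.extD_sum_covec_om1 (ξ η : Fin 2 → ℝ) :
    extD (fun Q => ∑ i, covec f i Q • om1 f i Q) P (vec1 f ξ P) (vec2 f η P) =
      -∑ i, ∑ j, qT f i j P * ξ i * η j := by
  have expand : extD (fun Q => ∑ i, covec f i Q • om1 f i Q) P (vec1 f ξ P) (vec2 f η P) =
      ∑ i, (covec f i P * ∑ j, ∑ k, Gam f i j k P * ξ j * η k -
        fderiv ℝ (covec f i) P (vec2 f η P) * ξ i) := by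
    refine (extDeriv₁_sum _ (θ := fun i Q => covec f i Q • om1 f i Q) (fun i _ =>
      (h.differentiableAt_covec i).smul (h.differentiableAt_om1 i)) _ _).trans ?_
    refine Finset.sum_congr rfl fun i _ => ?_
    rw [extDeriv₁_smul (h.differentiableAt_covec i) (h.differentiableAt_om1 i), h.om1_vec1,
      om1_vec2, ← h.extD_om1_vec1_vec2]
    simp only [extD, extDeriv₁]
    ring
  have nabla (i : Fin 2) := h.nablaA_vec2 i η
  simp only [nablaA, sub_apply, sum_apply, smul_apply, h.conn_vec2, smul_eq_mul] at nabla
  simp only [Fin.sum_univ_two] at nabla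
  rw [expand]
  simp only [Fin.sum_univ_two]
  linear_combination -ξ 0 * nabla 0 - ξ 1 * nabla 1

theorem IsWebAt.extD_sum_covec_om2 (ξ η : Fin 2 → ℝ) :
    extD (fun Q => ∑ i, covec f i Q • om2 f i Q) P (vec1 f ξ P) (vec2 f η P) =
      ∑ i, ∑ j, pT f i j P * ξ j * η i := by
  have expand : extD (fun Q => ∑ i, covec f i Q • om2 f i Q) P (vec1 f ξ P) (vec2 f η P) =
      ∑ i, (fderiv ℝ (covec f i) P (vec1 f ξ P) * η i -
        covec f i P * ∑ j, ∑ k, Gam f i j k P * ξ j * η k) := by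
    refine (extDeriv₁_sum _ (θ := fun i Q => covec f i Q • om2 f i Q) (fun i _ =>
      (h.differentiableAt_covec i).smul (h.differentiableAt_om2 i)) _ _).trans ?_
    refine Finset.sum_congr rfl fun i _ => ?_
    rw [extDeriv₁_smul (h.differentiableAt_covec i) (h.differentiableAt_om2 i), h.om2_vec2,
      om2_vec1, ← neg_neg (∑ j, ∑ k, Gam f i j k P * ξ j * η k), ← h.extD_om2_vec1_vec2]
    simp only [extD, extDeriv₁]
    ring
  have nabla (i : Fin 2) := h.nablaA_vec1 i ξ
  simp only [nablaA, sub_apply, sum_apply, smul_apply, h.conn_vec1, smul_eq_mul] at nabla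
  simp only [Fin.sum_univ_two] at nabla
  rw [expand]
  simp only [Fin.sum_univ_two]
  linear_combination η 0 * nabla 0 + η 1 * nabla 1

end Covector

section ClassB

variable {f : Space → Fin 2 → ℝ} {U : Set Space}

theorem IsThreeWeb.transversalCondition_of_isIntegrable (hw : IsThreeWeb f U)
    (hI : IsIntegrable 2 (transversalDist f) U) {P : Space} (hP : P ∈ U) :
    TransversalCondition f P := by
  have h := hw.isWebAt hP
  let ξ : Fin 2 → ℝ := ![covec f 1 P, -covec f 0 P]
  have mem_vec1 : vec1 f ξ P ∈ transversalDist f P := by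
    constructor <;> simp [h.om1_vec1, ξ, mul_comm]
  have mem_vec2 : vec2 f ξ P ∈ transversalDist f P := by
    constructor <;> simp [h.om2_vec2, ξ, mul_comm]
  have dom1 : extD (fun Q => ∑ i, covec f i Q • om1 f i Q) P (vec1 f ξ P) (vec2 f ξ P) = 0 :=
    hI.extD_eq_zero (fun Q _ v hv => by simpa using hv.1) hP
      (.fun_sum fun i _ => (h.differentiableAt_covec i).smul (h.differentiableAt_om1 i))
      mem_vec1 mem_vec2
  have dom2 : extD (fun Q => ∑ i, covec f i Q • om2 f i Q) P (vec1 f ξ P) (vec2 f ξ P) = 0 :=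
    hI.extD_eq_zero (fun Q _ v hv => by simpa using hv.2) hP
      (.fun_sum fun i _ => (h.differentiableAt_covec i).smul (h.differentiableAt_om2 i))
      mem_vec1 mem_vec2
  rw [h.extD_sum_covec_om1] at dom1
  rw [h.extD_sum_covec_om2] at dom2
  simp only [Fin.sum_univ_two, ξ, Matrix.cons_val_zero, Matrix.cons_val_one] at dom1 dom2
  constructor
  · linear_combination dom2
  · linear_combination -dom1

theorem IsThreeWeb.inClassB (hw : IsThreeWeb f U) {P : Space} (hP : P ∈ U)
    (hT : ¬ TransversalCondition f P) : InClassB f U :=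
  ⟨fun hI => hT (hw.transversalCondition_of_isIntegrable hI hP), fun hall => hT (hall P hP)⟩

end ClassB

section Connection

variable {E F ι : Type*} [NormedAddCommGroup E] [NormedSpace ℝ E] [NormedAddCommGroup F]
  [NormedSpace ℝ F] [Fintype ι]

/-- The covariant differential `dηⁱ + ηʲ κⱼⁱ` of a vector field with components `η` with respect to
the connection forms `κ j i = κⱼⁱ`. -/
noncomputable def covDeriv (κ : ι → ι → E → E →L[ℝ] ℝ) (η : ι → E → ℝ) (i : ι) (x : E) :
    E →L[ℝ] ℝ :=
  fderiv ℝ (η i) x + ∑ j, η j x • κ j i x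

/-- The curvature forms `dκⱼⁱ - κⱼᵐ ∧ κₘⁱ` of the connection forms `κ`. The components `curv` of the
web are definitionally their values for `conn` on the vectors `frame1`, `frame2`. -/
noncomputable def curvForm (κ : ι → ι → E → E →L[ℝ] ℝ) (j i : ι) (x u v : E) : ℝ :=
  extDeriv₁ (κ j i) x u v - ∑ m, (κ j m x u * κ m i x v - κ j m x v * κ m i x u)

theorem covDeriv_apply (κ : ι → ι → E → E →L[ℝ] ℝ) (η : ι → E → ℝ) (i : ι) (x u : E) :
    covDeriv κ η i x u = fderiv ℝ (η i) x u + ∑ j, η j x * κ j i x u := by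
  simp [covDeriv]

theorem differentiableAt_covDeriv {κ : ι → ι → E → E →L[ℝ] ℝ} {η : ι → E → ℝ} {x : E}
    (hη : ∀ i, ContDiffAt ℝ 2 (η i) x) (hκ : ∀ j i, DifferentiableAt ℝ (κ j i) x) (i : ι) :
    DifferentiableAt ℝ (covDeriv κ η i) x :=
  (((hη i).fderiv_right (m := 1) (by norm_num)).differentiableAt (by simp)).add <|
    .fun_sum fun j _ => ((hη j).differentiableAt (by simp)).smul (hκ j i)

theorem extDeriv₁_covDeriv {κ : ι → ι → E → E →L[ℝ] ℝ} {η : ι → E → ℝ} {x : E}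
    (hη : ∀ i, ContDiffAt ℝ 2 (η i) x) (hκ : ∀ j i, DifferentiableAt ℝ (κ j i) x) (i : ι)
    (u v : E) :
    extDeriv₁ (covDeriv κ η i) x u v =
      ∑ j, (covDeriv κ η j x u * κ j i x v - covDeriv κ η j x v * κ j i x u) +
        ∑ j, η j x * curvForm κ j i x u v := by
  have hη' (j) : DifferentiableAt ℝ (η j) x := (hη j).differentiableAt (by simp)
  have expand : extDeriv₁ (covDeriv κ η i) x u v =
      ∑ j, (fderiv ℝ (η j) x u * κ j i x v - fderiv ℝ (η j) x v * κ j i x u +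
        η j x * extDeriv₁ (κ j i) x u v) := by
    have hdη : DifferentiableAt ℝ (fderiv ℝ (η i)) x :=
      ((hη i).fderiv_right (m := 1) (by norm_num)).differentiableAt (by simp)
    have hηκ (j) : DifferentiableAt ℝ (fun y => η j y • κ j i y) x := (hη' j).smul (hκ j i)
    refine (extDeriv₁_add hdη (.fun_sum fun j _ => hηκ j) u v).trans ?_
    rw [extDeriv₁_fderiv (hη i), zero_add, extDeriv₁_sum _ fun j _ => hηκ j]
    exact Finset.sum_congr rfl fun j _ => extDeriv₁_smul (hη' j) (hκ j i) u v
  have sum_swap (u v : E) : ∑ j, (∑ m, η m x * κ m j x u) * κ j i x v =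
      ∑ j, η j x * ∑ m, κ j m x u * κ m i x v := by
    simp only [Finset.sum_mul, Finset.mul_sum, mul_assoc]
    exact Finset.sum_comm
  rw [expand]
  simp only [covDeriv_apply, curvForm, Finset.sum_add_distrib, Finset.sum_sub_distrib, add_mul,
    mul_sub, sum_swap]
  ring

theorem sum_mul_curvForm_of_covDeriv_eq_smul {κ : ι → ι → E → E →L[ℝ] ℝ} {η : ι → E → ℝ}
    {μ : E → E →L[ℝ] ℝ} {x : E} (hη : ∀ i, ContDiffAt ℝ 2 (η i) x)
    (hκ : ∀ j i, DifferentiableAt ℝ (κ j i) x) (hμ : DifferentiableAt ℝ μ x)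
    (hrec : ∀ᶠ y in 𝓝 x, ∀ i, covDeriv κ η i y = η i y • μ y) (i : ι) (u v : E) :
    ∑ j, η j x * curvForm κ j i x u v = η i x * extDeriv₁ μ x u v := by
  have ricci := extDeriv₁_covDeriv hη hκ i u v
  rw [extDeriv₁_congr (hrec.mono fun y hy => hy i),
    extDeriv₁_smul ((hη i).differentiableAt (by simp)) hμ] at ricci
  have rec_apply (j : ι) (w : E) : covDeriv κ η j x w = η j x * μ x w := by
    rw [hrec.self_of_nhds j]; rfl
  have dη (w : E) : fderiv ℝ (η i) x w = η i x * μ x w - ∑ j, η j x * κ j i x w := by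
    rw [← rec_apply, covDeriv_apply]; ring
  have sum_comm (u v : E) : ∑ j, η j x * μ x u * κ j i x v =
      μ x u * ∑ j, η j x * κ j i x v := by
    rw [Finset.mul_sum]
    exact Finset.sum_congr rfl fun j _ => by ring
  simp only [rec_apply, dη, Finset.sum_sub_distrib, sum_comm] at ricci
  linear_combination -ricci

theorem curvForm_pullback {κ : ι → ι → F → F →L[ℝ] ℝ} {φ : E → F} {x : E}
    (hφ : ContDiffAt ℝ 2 φ x) (hκ : ∀ j i, DifferentiableAt ℝ (κ j i) (φ x)) (j i : ι) (u v : E) :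
    curvForm (fun j i => pullback φ (κ j i)) j i x u v =
      curvForm κ j i (φ x) (fderiv ℝ φ x u) (fderiv ℝ φ x v) := by
  simp only [curvForm, extDeriv₁_pullback hφ (hκ j i), pullback_apply]

theorem exists_sum_mul_curvForm_eq {κ : ι → ι → E → E →L[ℝ] ℝ} {η : ι → E → ℝ} {x : E}
    (hη : ∀ i, ContDiffAt ℝ 2 (η i) x) (hκ : ∀ j i, DifferentiableAt ℝ (κ j i) x)
    (hηx : ∃ c, η c x ≠ 0)
    (hpar : ∀ᶠ y in 𝓝 x, ∀ i j, η i y • covDeriv κ η j y = η j y • covDeriv κ η i y) (u v : E) :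
    ∃ r : ℝ, ∀ i, ∑ j, η j x * curvForm κ j i x u v = η i x * r := by
  obtain ⟨c, hc⟩ := hηx
  have hηc : DifferentiableAt ℝ (η c) x := (hη c).differentiableAt (by simp)
  refine ⟨_, fun i => sum_mul_curvForm_of_covDeriv_eq_smul hη hκ
    (μ := fun y => (η c y)⁻¹ • covDeriv κ η c y)
    ((hηc.inv hc).smul (differentiableAt_covDeriv hη hκ c)) ?_ i u v⟩
  filter_upwards [hpar, hηc.continuousAt.eventually_ne hc] with y hy hcy i
  rw [smul_comm, ← hy c i, inv_smul_smul₀ hcy]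

end Connection

section TransversalSurfaces

variable {f : Space → Fin 2 → ℝ}

theorem exists_eq_smul_of_mul_eq_mul {K : Type*} [Field K] {x ξ : Fin 2 → K} (hξ : ξ ≠ 0)
    (h : ξ 1 * x 0 = ξ 0 * x 1) : ∃ a : K, x = a • ξ := by
  by_cases h0 : ξ 0 = 0
  · have h1 : ξ 1 ≠ 0 := fun h1 => hξ (by ext i; fin_cases i <;> assumption)
    refine ⟨x 1 / ξ 1, ?_⟩
    ext i; fin_cases i <;> simp_all
  · refine ⟨x 0 / ξ 0, ?_⟩
    ext i; fin_cases i <;> simp [field, h0]; linear_combination -h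

theorem vec1_smul (a : ℝ) (ξ : Fin 2 → ℝ) (P : Space) : vec1 f (a • ξ) P = a • vec1 f ξ P := by
  simp [vec1, Matrix.mulVec_smul]

theorem vec2_smul (a : ℝ) (ξ : Fin 2 → ℝ) (P : Space) : vec2 f (a • ξ) P = a • vec2 f ξ P := by
  simp [vec2, Matrix.mulVec_smul]

theorem transversalPlane_smul {c : ℝ} (hc : c ≠ 0) (ξ : Fin 2 → ℝ) (P : Space) :
    transversalPlane f (c • ξ) P = transversalPlane f ξ P := by
  ext v
  simp [transversalPlane, mul_assoc, ← mul_sub, hc]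

theorem IsWebAt.mem_transversalPlane_iff {P : Space} (h : IsWebAt f P) {ξ : Fin 2 → ℝ}
    (hξ : ξ ≠ 0) {v : Space} :
    v ∈ transversalPlane f ξ P ↔ ∃ a b : ℝ, v = a • vec1 f ξ P + b • vec2 f ξ P := by
  constructor
  · rintro ⟨h1, h2⟩
    obtain ⟨a, ha⟩ := exists_eq_smul_of_mul_eq_mul (x := fun i => om1 f i P v) hξ
      (sub_eq_zero.1 h1)
    obtain ⟨b, hb⟩ := exists_eq_smul_of_mul_eq_mul (x := fun i => om2 f i P v) hξ
      (sub_eq_zero.1 h2)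
    exact ⟨a, b, by rw [← vec1_smul, ← vec2_smul, ← ha, ← hb, h.vec1_om1_add_vec2_om2]⟩
  · rintro ⟨a, b, rfl⟩
    constructor <;> simp [h.om1_vec1, h.om2_vec2] <;> ring

theorem IsWebAt.vec1_mem_transversalPlane {P : Space} (h : IsWebAt f P) (ξ : Fin 2 → ℝ) :
    vec1 f ξ P ∈ transversalPlane f ξ P := by
  constructor <;> simp [h.om1_vec1, mul_comm]

theorem IsWebAt.vec2_mem_transversalPlane {P : Space} (h : IsWebAt f P) (ξ : Fin 2 → ℝ) :
    vec2 f ξ P ∈ transversalPlane f ξ P := by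
  constructor <;> simp [h.om2_vec2, mul_comm]

/-- `φ` parametrizes near `w` a surface whose tangent plane at `φ w` is one of the planes
`transversalPlane f η (φ w)`, in a three-web defined near `φ w`. -/
structure IsTransversalAt (f : Space → Fin 2 → ℝ) (φ : (Fin 2 → ℝ) → Space) (w : Fin 2 → ℝ) :
    Prop where
  isWebAt : IsWebAt f (φ w)
  contDiffAt : ContDiffAt ℝ ∞ φ w
  injective : Function.Injective (fderiv ℝ φ w)
  exists_range_eq : ∃ η : Fin 2 → ℝ, η ≠ 0 ∧
    LinearMap.range (fderiv ℝ φ w).toLinearMap = transversalPlane f η (φ w)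

/-- The components of the tangent vectors `dφ u` with respect to the forms `om1`. They serve as
the direction `η` of the tangent planes of a transversal surface `φ`, chosen smoothly. -/
noncomputable def direction (f : Space → Fin 2 → ℝ) (φ : (Fin 2 → ℝ) → Space) (u : Fin 2 → ℝ)
    (i : Fin 2) (w : Fin 2 → ℝ) : ℝ :=
  pullback φ (om1 f i) w u

namespace IsTransversalAt

variable {φ : (Fin 2 → ℝ) → Space} {w : Fin 2 → ℝ}

theorem contDiffAt_direction (h : IsTransversalAt f φ w) (u : Fin 2 → ℝ) (i : Fin 2) :
    ContDiffAt ℝ ∞ (direction f φ u i) w :=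
  (contDiffAt_pullback h.contDiffAt (h.isWebAt.contDiffAt_om1 i)).clm_apply contDiffAt_const

theorem range_eq_direction (h : IsTransversalAt f φ w) {u : Fin 2 → ℝ}
    (hu : (fun i => direction f φ u i w) ≠ 0) :
    LinearMap.range (fderiv ℝ φ w).toLinearMap =
      transversalPlane f (fun i => direction f φ u i w) (φ w) := by
  obtain ⟨ξ, hξ, hrange⟩ := h.exists_range_eq
  obtain ⟨a, b, hab⟩ := (h.isWebAt.mem_transversalPlane_iff hξ).1
    (hrange ▸ LinearMap.mem_range_self (fderiv ℝ φ w).toLinearMap u)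
  have direction_eq : (fun i => direction f φ u i w) = a • ξ := by
    ext i
    rw [direction, pullback_apply]
    simpa [h.isWebAt.om1_vec1] using congrArg (om1 f i (φ w)) hab
  have ha : a ≠ 0 := by
    rintro rfl
    exact hu (by simpa using direction_eq)
  rw [hrange, direction_eq, transversalPlane_smul ha]

theorem exists_fderiv_apply_eq (h : IsTransversalAt f φ w) {u : Fin 2 → ℝ}
    (hu : (fun i => direction f φ u i w) ≠ 0) (z : Fin 2 → ℝ) :
    ∃ a b : ℝ, fderiv ℝ φ w z = a • vec1 f (fun i => direction f φ u i w) (φ w) +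
      b • vec2 f (fun i => direction f φ u i w) (φ w) :=
  (h.isWebAt.mem_transversalPlane_iff hu).1
    (h.range_eq_direction hu ▸ LinearMap.mem_range_self (fderiv ℝ φ w).toLinearMap z)

theorem exists_fderiv_eq_vec1 (h : IsTransversalAt f φ w) {u : Fin 2 → ℝ}
    (hu : (fun i => direction f φ u i w) ≠ 0) :
    ∃ z, fderiv ℝ φ w z = vec1 f (fun i => direction f φ u i w) (φ w) :=
  LinearMap.mem_range.1 <|
    (h.range_eq_direction hu).symm ▸ h.isWebAt.vec1_mem_transversalPlane _

theorem exists_fderiv_eq_vec2 (h : IsTransversalAt f φ w) {u : Fin 2 → ℝ}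
    (hu : (fun i => direction f φ u i w) ≠ 0) :
    ∃ z, fderiv ℝ φ w z = vec2 f (fun i => direction f φ u i w) (φ w) :=
  LinearMap.mem_range.1 <|
    (h.range_eq_direction hu).symm ▸ h.isWebAt.vec2_mem_transversalPlane _

theorem direction_smul_pullback_om1 (h : IsTransversalAt f φ w) {u : Fin 2 → ℝ}
    (hu : (fun i => direction f φ u i w) ≠ 0) (i j : Fin 2) :
    direction f φ u i w • pullback φ (om1 f j) w =
      direction f φ u j w • pullback φ (om1 f i) w := by
  ext1 z
  obtain ⟨a, b, hab⟩ := h.exists_fderiv_apply_eq hu z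
  simp only [smul_apply, pullback_apply, hab, map_add, map_smul, h.isWebAt.om1_vec1, om1_vec2,
    smul_eq_mul]
  ring

theorem direction_smul_pullback_om2 (h : IsTransversalAt f φ w) {u : Fin 2 → ℝ}
    (hu : (fun i => direction f φ u i w) ≠ 0) (i j : Fin 2) :
    direction f φ u i w • pullback φ (om2 f j) w =
      direction f φ u j w • pullback φ (om2 f i) w := by
  ext1 z
  obtain ⟨a, b, hab⟩ := h.exists_fderiv_apply_eq hu z
  simp only [smul_apply, pullback_apply, hab, map_add, map_smul, h.isWebAt.om2_vec2, om2_vec1,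
    smul_eq_mul]
  ring

theorem direction_mul_covDeriv_of_fderiv_eq_vec2 (h : ∀ᶠ z in 𝓝 w, IsTransversalAt f φ z)
    {u : Fin 2 → ℝ} (hu : ∀ᶠ z in 𝓝 w, (fun i => direction f φ u i z) ≠ 0) (i j : Fin 2)
    {u' v' : Fin 2 → ℝ} (hu' : fderiv ℝ φ w u' = vec1 f (fun i => direction f φ u i w) (φ w))
    (hv' : fderiv ℝ φ w v' = vec2 f (fun i => direction f φ u i w) (φ w)) :
    direction f φ u i w *
        covDeriv (fun j i => pullback φ (conn f j i)) (direction f φ u) j w v' =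
      direction f φ u j w *
        covDeriv (fun j i => pullback φ (conn f j i)) (direction f φ u) i w v' := by
  have hw := h.self_of_nhds
  have dη (i) : DifferentiableAt ℝ (direction f φ u i) w :=
    (hw.contDiffAt_direction u i).differentiableAt (by simp)
  have dα (i) : DifferentiableAt ℝ (pullback φ (om1 f i)) w :=
    (contDiffAt_pullback hw.contDiffAt (hw.isWebAt.contDiffAt_om1 i)).differentiableAt (by simp)
  have hα (i) : extDeriv₁ (pullback φ (om1 f i)) w u' v' =
      ∑ j, ∑ k, Gam f i j k (φ w) * direction f φ u j w * direction f φ u k w := by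
    rw [extDeriv₁_pullback (hw.contDiffAt.of_le (by norm_cast))
      (hw.isWebAt.differentiableAt_om1 i), hu', hv', ← hw.isWebAt.extD_om1_vec1_vec2]
    rfl
  have parallel : (fun z => direction f φ u i z • pullback φ (om1 f j) z) =ᶠ[𝓝 w]
      fun z => direction f φ u j z • pullback φ (om1 f i) z := by
    filter_upwards [h, hu] with z hz huz using hz.direction_smul_pullback_om1 huz i j
  have key := congrFun₂ (extDeriv₁_congr parallel) u' v'
  rw [extDeriv₁_smul (dη i) (dα j), extDeriv₁_smul (dη j) (dα i)] at key
  simp only [pullback_apply, hu', hv', hw.isWebAt.om1_vec1, om1_vec2, hα] at key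
  simp only [covDeriv_apply, pullback_apply, hv', hw.isWebAt.conn_vec2]
  simp only [Fin.sum_univ_two] at key ⊢
  linear_combination key

theorem direction_mul_covDeriv_of_fderiv_eq_vec1 (h : ∀ᶠ z in 𝓝 w, IsTransversalAt f φ z)
    {u : Fin 2 → ℝ} (hu : ∀ᶠ z in 𝓝 w, (fun i => direction f φ u i z) ≠ 0) (i j : Fin 2)
    {u' v' : Fin 2 → ℝ} (hu' : fderiv ℝ φ w u' = vec1 f (fun i => direction f φ u i w) (φ w))
    (hv' : fderiv ℝ φ w v' = vec2 f (fun i => direction f φ u i w) (φ w)) :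
    direction f φ u i w *
        covDeriv (fun j i => pullback φ (conn f j i)) (direction f φ u) j w u' =
      direction f φ u j w *
        covDeriv (fun j i => pullback φ (conn f j i)) (direction f φ u) i w u' := by
  have hw := h.self_of_nhds
  have dη (i) : DifferentiableAt ℝ (direction f φ u i) w :=
    (hw.contDiffAt_direction u i).differentiableAt (by simp)
  have dβ (i) : DifferentiableAt ℝ (pullback φ (om2 f i)) w :=
    (contDiffAt_pullback hw.contDiffAt (hw.isWebAt.contDiffAt_om2 i)).differentiableAt (by simp)
  have hβ (i) : extDeriv₁ (pullback φ (om2 f i)) w u' v' =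
      -∑ j, ∑ k, Gam f i j k (φ w) * direction f φ u j w * direction f φ u k w := by
    rw [extDeriv₁_pullback (hw.contDiffAt.of_le (by norm_cast))
      (hw.isWebAt.differentiableAt_om2 i), hu', hv', ← hw.isWebAt.extD_om2_vec1_vec2]
    rfl
  have parallel : (fun z => direction f φ u i z • pullback φ (om2 f j) z) =ᶠ[𝓝 w]
      fun z => direction f φ u j z • pullback φ (om2 f i) z := by
    filter_upwards [h, hu] with z hz huz using hz.direction_smul_pullback_om2 huz i j
  have key := congrFun₂ (extDeriv₁_congr parallel) u' v'
  rw [extDeriv₁_smul (dη i) (dβ j), extDeriv₁_smul (dη j) (dβ i)] at key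
  simp only [pullback_apply, hu', hv', hw.isWebAt.om2_vec2, om2_vec1, hβ] at key
  simp only [covDeriv_apply, pullback_apply, hu', hw.isWebAt.conn_vec1]
  simp only [Fin.sum_univ_two] at key ⊢
  linear_combination -key

theorem direction_smul_covDeriv (h : ∀ᶠ z in 𝓝 w, IsTransversalAt f φ z) {u : Fin 2 → ℝ}
    (hu : ∀ᶠ z in 𝓝 w, (fun i => direction f φ u i z) ≠ 0) (i j : Fin 2) :
    direction f φ u i w • covDeriv (fun j i => pullback φ (conn f j i)) (direction f φ u) j w =
      direction f φ u j w •
        covDeriv (fun j i => pullback φ (conn f j i)) (direction f φ u) i w := by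
  have hw := h.self_of_nhds
  obtain ⟨u', hu'⟩ := hw.exists_fderiv_eq_vec1 hu.self_of_nhds
  obtain ⟨v', hv'⟩ := hw.exists_fderiv_eq_vec2 hu.self_of_nhds
  ext1 z
  obtain ⟨a, b, hab⟩ := hw.exists_fderiv_apply_eq hu.self_of_nhds z
  have hz : z = a • u' + b • v' := hw.injective (by rw [hab, map_add, map_smul, map_smul, hu', hv'])
  simp only [hz, smul_apply, map_add, map_smul, smul_eq_mul]
  linear_combination a * direction_mul_covDeriv_of_fderiv_eq_vec1 h hu i j hu' hv' +
    b * direction_mul_covDeriv_of_fderiv_eq_vec2 h hu i j hu' hv'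

theorem exists_sum_mul_curvForm_conn_eq (h : ∀ᶠ z in 𝓝 w, IsTransversalAt f φ z)
    {u : Fin 2 → ℝ} (hu : (fun i => direction f φ u i w) ≠ 0) (u' v' : Fin 2 → ℝ) :
    ∃ r : ℝ, ∀ i, ∑ j, direction f φ u j w *
      curvForm (conn f) j i (φ w) (fderiv ℝ φ w u') (fderiv ℝ φ w v') =
        direction f φ u i w * r := by
  have hw := h.self_of_nhds
  have hη (i) : ContDiffAt ℝ ∞ (direction f φ u i) w := hw.contDiffAt_direction u i
  have direction_ne : ∀ᶠ z in 𝓝 w, (fun i => direction f φ u i z) ≠ 0 :=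
    (continuousAt_pi.2 fun i => (hη i).continuousAt).eventually_ne hu
  have hκ (j i) : DifferentiableAt ℝ (pullback φ (conn f j i)) w :=
    (contDiffAt_pullback hw.contDiffAt (hw.isWebAt.contDiffAt_conn j i)).differentiableAt (by simp)
  have parallel : ∀ᶠ z in 𝓝 w, ∀ i j,
      direction f φ u i z • covDeriv (fun j i => pullback φ (conn f j i)) (direction f φ u) j z =
        direction f φ u j z •
          covDeriv (fun j i => pullback φ (conn f j i)) (direction f φ u) i z := by
    filter_upwards [h.eventually_nhds, direction_ne.eventually_nhds] with z hz huz i j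
      using direction_smul_covDeriv hz huz i j
  obtain ⟨r, hr⟩ := exists_sum_mul_curvForm_eq (fun i => (hη i).of_le (by norm_cast)) hκ
    (Function.ne_iff.1 hu) parallel u' v'
  refine ⟨r, fun i => ?_⟩
  simpa only [curvForm_pullback (hw.contDiffAt.of_le (by norm_cast))
    hw.isWebAt.differentiableAt_conn] using hr i

end IsTransversalAt

end TransversalSurfaces

section ClassC

variable {f : Space → Fin 2 → ℝ} {P : Space}

theorem curvForm_conn_vec1_vec2 (j i : Fin 2) (ξ η : Fin 2 → ℝ) :
    curvForm (conn f) j i P (vec1 f ξ P) (vec2 f η P) =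
      ∑ k, ∑ l, ξ k * η l * curv f i j k l P := by
  simp only [vec1_eq_sum, vec2_eq_sum, curvForm, extDeriv₁, curv, extD, wedge, Fin.sum_univ_two,
    map_add, map_smul, add_apply, smul_apply, smul_eq_mul]
  ring

theorem exists_sym3_eq_of_forall_exists_mul_eq {T : Fin 2 → Fin 2 → Fin 2 → Fin 2 → ℝ}
    (hT : ∀ ξ : Fin 2 → ℝ, ξ ≠ 0 → ∃ r : ℝ, ∀ i,
      ∑ j, ξ j * ∑ k, ∑ l, ξ k * ξ l * T i j k l = ξ i * r) :
    ∃ B : Fin 2 → Fin 2 → ℝ, ∀ i j k l,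
      sym3 (T i) j k l = sym3 (fun j k l => (if i = j then 1 else 0) * B k l) j k l := by
  have quartic (s t : ℝ) (hst : s ≠ 0 ∨ t ≠ 0) :
      s * (s ^ 3 * sym3 (T 1) 0 0 0 + 3 * s ^ 2 * t * sym3 (T 1) 0 0 1 +
          3 * s * t ^ 2 * sym3 (T 1) 0 1 1 + t ^ 3 * sym3 (T 1) 1 1 1) =
        t * (s ^ 3 * sym3 (T 0) 0 0 0 + 3 * s ^ 2 * t * sym3 (T 0) 0 0 1 +
          3 * s * t ^ 2 * sym3 (T 0) 0 1 1 + t ^ 3 * sym3 (T 0) 1 1 1) := by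
    obtain ⟨r, hr⟩ := hT ![s, t] (by simpa [← not_and_or] using hst)
    have hr0 := hr 0
    have hr1 := hr 1
    simp only [Fin.sum_univ_two, Matrix.cons_val_zero, Matrix.cons_val_one] at hr0 hr1
    simp only [sym3]
    linear_combination s * hr1 - t * hr0
  obtain ⟨h0, h1, h2, h3, h4⟩ : sym3 (T 1) 0 0 0 = 0 ∧ 3 * sym3 (T 1) 0 0 1 = sym3 (T 0) 0 0 0 ∧
      sym3 (T 1) 0 1 1 = sym3 (T 0) 0 0 1 ∧ sym3 (T 1) 1 1 1 = 3 * sym3 (T 0) 0 1 1 ∧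
      sym3 (T 0) 1 1 1 = 0 := by
    have h10 := quartic 1 0 (by simp)
    have h01 := quartic 0 1 (by simp)
    have h11 := quartic 1 1 (by simp)
    have h1m := quartic 1 (-1) (by simp)
    have h12 := quartic 1 2 (by simp)
    refine ⟨?_, ?_, ?_, ?_, ?_⟩ <;> linarith
  simp only [sym3] at h0 h1 h2 h3 h4
  refine ⟨!![sym3 (T 0) 0 0 0, 3 / 2 * sym3 (T 0) 0 0 1;
    3 / 2 * sym3 (T 0) 0 0 1, 3 * sym3 (T 0) 0 1 1], fun i j k l => ?_⟩
  fin_cases i <;> fin_cases j <;> fin_cases k <;> fin_cases l <;> simp [sym3] <;> linarith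

theorem CurvatureCondition.sym3_curv_eq (hC : CurvatureCondition f P) :
    sym3 (fun j k l => curv f 0 j k l P) 0 0 0 = 3 * sym3 (fun j k l => curv f 1 j k l P) 0 0 1 ∧
      sym3 (fun j k l => curv f 0 j k l P) 0 0 1 = sym3 (fun j k l => curv f 1 j k l P) 0 1 1 := by
  obtain ⟨B, hB⟩ := hC
  simp only [hB]
  constructor
  · simp [sym3]
    ring
  · simp [sym3]

theorem IsThreeWeb.curvatureCondition_of_isTransversallyGeodesic {U : Set Space}
    (hw : IsThreeWeb f U) (hG : IsTransversallyGeodesic f U) (hP : P ∈ U) :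
    CurvatureCondition f P := by
  refine exists_sym3_eq_of_forall_exists_mul_eq fun ξ hξ => ?_
  obtain ⟨W, φ, hW, h0, rfl, hWU, hφ, hrange, htang⟩ := hG P hP ξ hξ
  have h := hw.isWebAt hP
  have transversal : ∀ᶠ w in 𝓝 0, IsTransversalAt f φ w := by
    filter_upwards [hW.mem_nhds h0] with w hwW
    exact ⟨hw.isWebAt (hWU hwW), hφ.contDiffAt (hW.mem_nhds hwW), (htang w hwW).1,
      (htang w hwW).2⟩
  obtain ⟨u, hu⟩ : ∃ u, fderiv ℝ φ 0 u = vec1 f ξ (φ 0) :=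
    LinearMap.mem_range.1 (hrange.symm ▸ h.vec1_mem_transversalPlane ξ)
  obtain ⟨v, hv⟩ : ∃ v, fderiv ℝ φ 0 v = vec2 f ξ (φ 0) :=
    LinearMap.mem_range.1 (hrange.symm ▸ h.vec2_mem_transversalPlane ξ)
  have direction_eq (i) : direction f φ u i 0 = ξ i :=
    (congrArg (om1 f i (φ 0)) hu).trans (h.om1_vec1 i ξ)
  obtain ⟨r, hr⟩ := IsTransversalAt.exists_sum_mul_curvForm_conn_eq transversal (u := u)
    (by simpa only [direction_eq] using hξ) u v
  refine ⟨r, fun i => ?_⟩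
  simpa only [direction_eq, hu, hv, curvForm_conn_vec1_vec2] using hr i

theorem IsThreeWeb.inClassC {U : Set Space} (hw : IsThreeWeb f U) (hP : P ∈ U)
    (hC : ¬ CurvatureCondition f P) : InClassC f U :=
  ⟨fun hG => hC (hw.curvatureCondition_of_isTransversallyGeodesic hG hP),
    fun hall => hC (hall P hP)⟩

end ClassC

section AnalyticDensity

theorem dense_ne_zero_of_analyticOnNhd {𝕜 E F : Type*} [NontriviallyNormedField 𝕜]
    [NormedAddCommGroup E] [NormedSpace 𝕜 E] [NormedAddCommGroup F] [NormedSpace 𝕜 F]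
    [PreconnectedSpace E] {g : E → F} (hg : AnalyticOnNhd 𝕜 g Set.univ) {x₀ : E}
    (hx₀ : g x₀ ≠ 0) : Dense {x | g x ≠ 0} := by
  intro x
  by_contra hx
  rw [mem_closure_iff_frequently, not_frequently] at hx
  have eq_zero : g =ᶠ[𝓝 x] 0 := hx.mono fun y hy => not_not.1 hy
  exact hx₀ (hg.eqOn_zero_of_preconnected_of_eventuallyEq_zero isPreconnected_univ
    (Set.mem_univ x) eq_zero (Set.mem_univ x₀))

theorem dense_setOf_generic : Dense {P : Space | 1 + P.1 0 * P.2 1 ≠ 0 ∧ P.1 0 * P.2 1 ≠ 1 ∧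
    P.1 0 ≠ 0 ∧ P.2 1 ≠ 0 ∧ P.1 0 ≠ -P.2 1} := by
  have hx : AnalyticOnNhd ℝ (fun P : Space => P.1 0) Set.univ := (dx 0).analyticOnNhd _
  have hy : AnalyticOnNhd ℝ (fun P : Space => P.2 1) Set.univ := (dy 1).analyticOnNhd _
  have hg : AnalyticOnNhd ℝ (fun P : Space => (1 + P.1 0 * P.2 1) * (P.1 0 * P.2 1 - 1) *
      P.1 0 * P.2 1 * (P.1 0 + P.2 1)) Set.univ :=
    ((((analyticOnNhd_const.add (hx.mul hy)).mul ((hx.mul hy).sub analyticOnNhd_const)).mul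
      hx).mul hy).mul (hx.add hy)
  have hdense := dense_ne_zero_of_analyticOnNhd hg (x₀ := (![1, 0], ![0, 2])) (by norm_num)
  refine hdense.mono fun P hP => ?_
  simpa [and_assoc, sub_eq_zero, add_eq_zero_iff_eq_neg] using hP

end AnalyticDensity

section WebMap

theorem hasFDerivAt_div {𝕜 E : Type*} [NontriviallyNormedField 𝕜] [NormedAddCommGroup E]
    [NormedSpace 𝕜 E] {g h : E → 𝕜} {g' h' : E →L[𝕜] 𝕜} {x : E} (hg : HasFDerivAt g g' x)
    (hh : HasFDerivAt h h' x) (h0 : h x ≠ 0) :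
    HasFDerivAt (fun y => g y / h y) ((h x ^ 2)⁻¹ • (h x • g' - g x • h')) x := by
  have hmul := hg.fun_mul ((hasDerivAt_inv h0).comp_hasFDerivAt x hh)
  simp only [Function.comp_apply, ← div_eq_mul_inv] at hmul
  refine hmul.congr_fderiv (ContinuousLinearMap.ext fun v => ?_)
  simp
  field_simp
  ring

theorem hasFDerivAt_x (j : Fin 2) (P : Space) : HasFDerivAt (fun Q : Space => Q.1 j) (dx j) P :=
  (dx j).hasFDerivAt

theorem hasFDerivAt_y (j : Fin 2) (P : Space) : HasFDerivAt (fun Q : Space => Q.2 j) (dy j) P :=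
  (dy j).hasFDerivAt

theorem hasFDerivAt_one_add_mul (P : Space) :
    HasFDerivAt (fun Q : Space => 1 + Q.1 0 * Q.2 1) (P.1 0 • dy 1 + P.2 1 • dx 0) P :=
  ((hasFDerivAt_x 0 P).fun_mul (hasFDerivAt_y 1 P)).const_add 1

theorem contDiff_webMap : ContDiff ℝ ∞ webMap := by
  have hx (j : Fin 2) : ContDiff ℝ ∞ fun P : Space => P.1 j := (dx j).contDiff
  have hy (j : Fin 2) : ContDiff ℝ ∞ fun P : Space => P.2 j := (dy j).contDiff
  refine contDiff_pi.2 fun i => ?_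
  fin_cases i
  · exact ((hx 0).add (hy 0)).add ((contDiff_const.mul ((hx 0).pow 2)).mul (hy 1))
  · exact ((hx 1).add (hy 1)).add ((contDiff_const.mul (hx 0)).mul ((hy 1).pow 2))

theorem hasFDerivAt_webMap_zero (P : Space) :
    HasFDerivAt (fun Q => webMap Q 0)
      ((1 + P.1 0 * P.2 1) • dx 0 + dy 0 + (P.1 0 ^ 2 / 2) • dy 1) P := by
  refine (((hasFDerivAt_x 0 P).add (hasFDerivAt_y 0 P)).add
    ((((hasFDerivAt_x 0 P).pow 2).const_mul (1 / 2)).mul (hasFDerivAt_y 1 P))).congr_fderiv ?_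
  refine ContinuousLinearMap.ext fun v => ?_
  simp
  ring

theorem hasFDerivAt_webMap_one (P : Space) :
    HasFDerivAt (fun Q => webMap Q 1)
      ((P.2 1 ^ 2 / 2) • dx 0 + dx 1 + (1 + P.1 0 * P.2 1) • dy 1) P := by
  refine (((hasFDerivAt_x 1 P).add (hasFDerivAt_y 1 P)).add
    (((hasFDerivAt_x 0 P).const_mul (1 / 2)).mul ((hasFDerivAt_y 1 P).pow 2))).congr_fderiv ?_
  refine ContinuousLinearMap.ext fun v => ?_
  simp
  ring

theorem fBar_webMap (P : Space) :
    fBar webMap P = !![1 + P.1 0 * P.2 1, 0; P.2 1 ^ 2 / 2, 1] := by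
  ext i j
  fin_cases i <;> fin_cases j <;>
    simp [fBar, ddx, (hasFDerivAt_webMap_zero P).fderiv, (hasFDerivAt_webMap_one P).fderiv,
      dx_apply, dy_apply]

theorem fTilde_webMap (P : Space) :
    fTilde webMap P = !![1, P.1 0 ^ 2 / 2; 0, 1 + P.1 0 * P.2 1] := by
  ext i j
  fin_cases i <;> fin_cases j <;>
    simp [fTilde, ddy, (hasFDerivAt_webMap_zero P).fderiv, (hasFDerivAt_webMap_one P).fderiv,
      dx_apply, dy_apply]

theorem det_fBar_webMap (P : Space) : (fBar webMap P).det = 1 + P.1 0 * P.2 1 := by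
  simp [fBar_webMap, Matrix.det_fin_two]

theorem det_fTilde_webMap (P : Space) : (fTilde webMap P).det = 1 + P.1 0 * P.2 1 := by
  simp [fTilde_webMap, Matrix.det_fin_two]

theorem isThreeWeb_webMap {U : Set Space} (hU : IsOpen U)
    (hD : ∀ P ∈ U, 1 + P.1 0 * P.2 1 ≠ 0) : IsThreeWeb webMap U :=
  ⟨hU, contDiff_webMap.contDiffOn, fun P hP =>
    ⟨(det_fBar_webMap P).trans_ne (hD P hP), (det_fTilde_webMap P).trans_ne (hD P hP)⟩⟩

theorem isWebAt_webMap {P : Space} (hD : 1 + P.1 0 * P.2 1 ≠ 0) : IsWebAt webMap P :=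
  ⟨contDiff_webMap.contDiffAt, (det_fBar_webMap P).trans_ne hD, (det_fTilde_webMap P).trans_ne hD⟩

theorem inv_fBar_webMap (P : Space) :
    (fBar webMap P)⁻¹ =
      (1 + P.1 0 * P.2 1)⁻¹ • !![1, 0; -(P.2 1 ^ 2 / 2), 1 + P.1 0 * P.2 1] := by
  rw [Matrix.inv_def, det_fBar_webMap, fBar_webMap, Matrix.adjugate_fin_two, Ring.inverse_eq_inv']
  simp

theorem inv_fTilde_webMap (P : Space) :
    (fTilde webMap P)⁻¹ =
      (1 + P.1 0 * P.2 1)⁻¹ • !![1 + P.1 0 * P.2 1, -(P.1 0 ^ 2 / 2); 0, 1] := by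
  rw [Matrix.inv_def, det_fTilde_webMap, fTilde_webMap, Matrix.adjugate_fin_two,
    Ring.inverse_eq_inv']
  simp

theorem om1_webMap_zero (P : Space) : om1 webMap 0 P = (1 + P.1 0 * P.2 1) • dx 0 := by
  simp [om1, fBar_webMap]

theorem om2_webMap_one (P : Space) : om2 webMap 1 P = (1 + P.1 0 * P.2 1) • dy 1 := by
  simp [om2, fTilde_webMap]

theorem ddx_ddy_webMap (i l m : Fin 2) (P : Space) :
    ddx l (ddy m (fun Q => webMap Q i)) P =
      if l = 0 ∧ m = 1 then ![P.1 0, P.2 1] i else 0 := by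
  have ddy_eq : ddy m (fun Q => webMap Q i) =
      fun Q => !![1, 1 / 2 * Q.1 0 ^ 2; 0, 1 + Q.1 0 * Q.2 1] i m := by
    funext Q
    change fTilde webMap Q i m = _
    rw [fTilde_webMap, one_div_mul_eq_div]
  rw [ddy_eq, ddx]
  fin_cases i <;> fin_cases m <;>
    simp [(hasFDerivAt_one_add_mul P).fderiv,
      (((hasFDerivAt_x 0 P).pow 2).const_mul 2⁻¹).fderiv, dx_apply, dy_apply,
      Pi.single_apply, eq_comm]

theorem Gam_webMap (i j k : Fin 2) (P : Space) :
    Gam webMap i j k P =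
      if j = 0 ∧ k = 1 then -(![P.1 0, P.2 1] i / (1 + P.1 0 * P.2 1) ^ 2) else 0 := by
  fin_cases j <;> fin_cases k <;>
    simp [Gam, ddx_ddy_webMap, inv_fBar_webMap, inv_fTilde_webMap, div_eq_mul_inv, sq, mul_assoc]

theorem covec_webMap (j : Fin 2) (P : Space) :
    covec webMap j P = ![-P.2 1, P.1 0] j / (1 + P.1 0 * P.2 1) ^ 2 := by
  fin_cases j <;> simp [covec, torsion, Gam_webMap] <;> ring

theorem conn_webMap {P : Space} (hD : 1 + P.1 0 * P.2 1 ≠ 0) (j i : Fin 2) :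
    conn webMap j i P = (-(![P.1 0, P.2 1] i / (1 + P.1 0 * P.2 1))) • ![dy 1, dx 0] j := by
  refine ContinuousLinearMap.ext fun v => ?_
  fin_cases j <;> simp [conn, Gam_webMap, om1_webMap_zero, om2_webMap_one] <;> field_simp

theorem frame1_webMap (k : Fin 2) (P : Space) :
    frame1 webMap k P =
      ((1 + P.1 0 * P.2 1)⁻¹ • ![![1, -(P.2 1 ^ 2 / 2)], ![0, 1 + P.1 0 * P.2 1]] k, 0) := by
  ext i <;> fin_cases k <;> fin_cases i <;> simp [frame1, inv_fBar_webMap]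

theorem frame2_webMap (l : Fin 2) (P : Space) :
    frame2 webMap l P =
      (0, (1 + P.1 0 * P.2 1)⁻¹ • ![![1 + P.1 0 * P.2 1, 0], ![-(P.1 0 ^ 2 / 2), 1]] l) := by
  ext i <;> fin_cases l <;> fin_cases i <;> simp [frame2, inv_fTilde_webMap]

theorem nablaA_webMap_zero {P : Space} (hD : 1 + P.1 0 * P.2 1 ≠ 0) :
    nablaA webMap 0 P = (2 * P.2 1 ^ 2 / (1 + P.1 0 * P.2 1) ^ 3) • dx 0 +
        ((P.1 0 * P.2 1 - 1) / (1 + P.1 0 * P.2 1) ^ 3) • dy 1 := by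
  have hcovec := (hasFDerivAt_div (hasFDerivAt_y 1 P).fun_neg
    ((hasFDerivAt_one_add_mul P).pow 2) (pow_ne_zero 2 hD)).congr_of_eventuallyEq
    (.of_forall (covec_webMap 0))
  refine ContinuousLinearMap.ext fun v => ?_
  simp [nablaA, hcovec.fderiv, covec_webMap, conn_webMap hD]
  field_simp
  ring

theorem nablaA_webMap_one {P : Space} (hD : 1 + P.1 0 * P.2 1 ≠ 0) :
    nablaA webMap 1 P = ((1 - P.1 0 * P.2 1) / (1 + P.1 0 * P.2 1) ^ 3) • dx 0 -
        (2 * P.1 0 ^ 2 / (1 + P.1 0 * P.2 1) ^ 3) • dy 1 := by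
  have hcovec := (hasFDerivAt_div (hasFDerivAt_x 0 P)
    ((hasFDerivAt_one_add_mul P).pow 2) (pow_ne_zero 2 hD)).congr_of_eventuallyEq
    (.of_forall (covec_webMap 1))
  refine ContinuousLinearMap.ext fun v => ?_
  simp [nablaA, hcovec.fderiv, covec_webMap, conn_webMap hD]
  field_simp
  ring

theorem pT_webMap {P : Space} (hD : 1 + P.1 0 * P.2 1 ≠ 0) (i j : Fin 2) :
    pT webMap i j P =
      !![2 * P.2 1 ^ 2, 0; 1 - P.1 0 * P.2 1, 0] i j / (1 + P.1 0 * P.2 1) ^ 4 := by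
  fin_cases i <;> fin_cases j <;>
    simp [pT, nablaA_webMap_zero hD, nablaA_webMap_one hD, frame1_webMap, dx_apply, dy_apply] <;>
    field_simp

theorem qT_webMap {P : Space} (hD : 1 + P.1 0 * P.2 1 ≠ 0) (i j : Fin 2) :
    qT webMap i j P =
      !![0, P.1 0 * P.2 1 - 1; 0, -(2 * P.1 0 ^ 2)] i j / (1 + P.1 0 * P.2 1) ^ 4 := by
  fin_cases i <;> fin_cases j <;>
    simp [qT, nablaA_webMap_zero hD, nablaA_webMap_one hD, frame2_webMap, dx_apply, dy_apply] <;>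
    field_simp

theorem pT_one_eq_zero_and_qT_zero_eq_zero_webMap {P : Space} (hD : 1 + P.1 0 * P.2 1 ≠ 0)
    (i : Fin 2) : pT webMap i 1 P = 0 ∧ qT webMap i 0 P = 0 := by
  fin_cases i <;> simp [pT_webMap hD, qT_webMap hD]

theorem pT_eq_neg_qT_webMap {P : Space} (hD : 1 + P.1 0 * P.2 1 ≠ 0) :
    pT webMap 1 0 P = -qT webMap 0 1 P := by
  simp [pT_webMap hD, qT_webMap hD, ← neg_div]

theorem pAlt_webMap {P : Space} (hD : 1 + P.1 0 * P.2 1 ≠ 0) :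
    pAlt webMap P = (P.1 0 * P.2 1 - 1) / (1 + P.1 0 * P.2 1) ^ 4 / 2 := by
  simp [pAlt, pT_webMap hD, ← neg_div]

theorem pAlt_eq_qAlt_webMap {P : Space} (hD : 1 + P.1 0 * P.2 1 ≠ 0) :
    pAlt webMap P = qAlt webMap P := by
  simp [pAlt_webMap hD, qAlt, qT_webMap hD]

theorem inClassG3_webMap_iff {U : Set Space} (hD : ∀ P ∈ U, 1 + P.1 0 * P.2 1 ≠ 0) :
    InClassG3 webMap U ↔ ∀ P ∈ U, P.1 0 * P.2 1 ≠ 1 := by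
  refine forall₂_congr fun P hP => ?_
  rw [← pAlt_eq_qAlt_webMap (hD P hP), pAlt_webMap (hD P hP)]
  simp [hD P hP, sub_eq_zero]

theorem inClassE1_webMap_iff {U : Set Space} (hD : ∀ P ∈ U, 1 + P.1 0 * P.2 1 ≠ 0) :
    InClassE1 webMap U ↔ ∀ P ∈ U, P.1 0 ≠ 0 ∧ P.2 1 ≠ 0 ∧ P.1 0 ≠ -P.2 1 := by
  refine forall₂_congr fun P hP => ?_
  simp only [covec_webMap, Matrix.cons_val_zero, Matrix.cons_val_one, ne_eq,
    div_left_inj' (pow_ne_zero 2 (hD P hP)), div_eq_zero_iff, pow_eq_zero_iff two_ne_zero, hD P hP,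
    or_false, neg_eq_zero]
  rw [and_left_comm, eq_comm (a := -P.2 1)]

theorem inClassE111_webMap_iff {U : Set Space} (hD : ∀ P ∈ U, 1 + P.1 0 * P.2 1 ≠ 0) :
    InClassE111 webMap U ↔ ∀ P ∈ U, P.1 0 ≠ 0 ∧ P.2 1 ≠ 0 ∧ P.1 0 ≠ -P.2 1 := by
  rw [InClassE111, InClassE11, and_assoc, inClassE1_webMap_iff hD]
  exact and_iff_left ⟨fun P hP => pT_one_eq_zero_and_qT_zero_eq_zero_webMap (hD P hP),
    fun P hP => pT_eq_neg_qT_webMap (hD P hP)⟩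

theorem not_transversalCondition_webMap {P : Space} (hD : 1 + P.1 0 * P.2 1 ≠ 0)
    (hx : P.1 0 ≠ 0) (hy : P.2 1 ≠ 0) : ¬ TransversalCondition webMap P := by
  rintro ⟨-, hq⟩
  have key : -(P.1 0 * P.2 1 * (1 + P.1 0 * P.2 1)) / (1 + P.1 0 * P.2 1) ^ 8 = 0 := by
    rw [← hq]
    simp [covec_webMap, qT_webMap hD]
    field_simp
    ring
  simp [hx, hy, hD] at key

theorem extD_conn_webMap {P : Space} (hD : 1 + P.1 0 * P.2 1 ≠ 0) (j i : Fin 2) (u v : Space) :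
    extD (conn webMap j i) P u v =
      -((1 + P.1 0 * P.2 1) ^ 2)⁻¹ *
        (![dx 0 - P.1 0 ^ 2 • dy 1, dy 1 - P.2 1 ^ 2 • dx 0] i u * ![dy 1, dx 0] j v -
          ![dx 0 - P.1 0 ^ 2 • dy 1, dy 1 - P.2 1 ^ 2 • dx 0] i v * ![dy 1, dx 0] j u) := by
  have hcoeff : HasFDerivAt (fun Q : Space => -(![Q.1 0, Q.2 1] i / (1 + Q.1 0 * Q.2 1)))
      (-(((1 + P.1 0 * P.2 1) ^ 2)⁻¹ •
        ![dx 0 - P.1 0 ^ 2 • dy 1, dy 1 - P.2 1 ^ 2 • dx 0] i)) P := by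
    fin_cases i
    · refine (hasFDerivAt_div (hasFDerivAt_x 0 P) (hasFDerivAt_one_add_mul P)
        hD).fun_neg.congr_fderiv ?_
      change _ = -(_ • (dx 0 - P.1 0 ^ 2 • dy 1))
      module
    · refine (hasFDerivAt_div (hasFDerivAt_y 1 P) (hasFDerivAt_one_add_mul P)
        hD).fun_neg.congr_fderiv ?_
      change _ = -(_ • (dy 1 - P.2 1 ^ 2 • dx 0))
      module
  have hconn : conn webMap j i =ᶠ[𝓝 P]
      fun Q => (-(![Q.1 0, Q.2 1] i / (1 + Q.1 0 * Q.2 1))) • ![dy 1, dx 0] j :=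
    ((hasFDerivAt_one_add_mul P).continuousAt.eventually_ne hD).mono fun Q hQ => conn_webMap hQ j i
  calc extD (conn webMap j i) P u v
      = extDeriv₁ (fun Q : Space => (-(![Q.1 0, Q.2 1] i / (1 + Q.1 0 * Q.2 1))) •
          ![dy 1, dx 0] j) P u v := congrFun₂ (extDeriv₁_congr hconn) u v
    _ = _ := by
      rw [extDeriv₁_smul hcoeff.differentiableAt (differentiableAt_const _), extDeriv₁_const,
        hcoeff.fderiv]
      simp only [neg_apply, smul_apply, smul_eq_mul]
      ring

theorem curv_webMap {P : Space} (hD : 1 + P.1 0 * P.2 1 ≠ 0) (i j k l : Fin 2) :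
    curv webMap i j k l P = if k = 0 ∧ l = 1 then
      !![P.1 0 * P.2 1 - 1, -(2 * P.1 0 ^ 2); 2 * P.2 1 ^ 2, 1 - P.1 0 * P.2 1] i j /
        (1 + P.1 0 * P.2 1) ^ 4 else 0 := by
  rw [curv, extD_conn_webMap hD]
  fin_cases k <;> fin_cases l <;> fin_cases i <;> fin_cases j <;>
    simp [wedge, conn_webMap hD, frame1_webMap, frame2_webMap, dx_apply, dy_apply] <;>
    field_simp <;> ring

theorem not_curvatureCondition_webMap {P : Space} (hD : 1 + P.1 0 * P.2 1 ≠ 0) :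
    ¬ CurvatureCondition webMap P := by
  intro hC
  let S (i : Fin 2) := sym3 fun j k l => curv webMap i j k l P
  have sym_0_000 : S 0 0 0 0 = 0 := by simp [S, sym3, curv_webMap hD]
  have sym_1_001 : S 1 0 0 1 = 2 * P.2 1 ^ 2 / (1 + P.1 0 * P.2 1) ^ 4 / 3 := by
    simp [S, sym3, curv_webMap hD]
    ring
  have sym_0_001 : S 0 0 0 1 = (P.1 0 * P.2 1 - 1) / (1 + P.1 0 * P.2 1) ^ 4 / 3 := by
    simp [S, sym3, curv_webMap hD]
    ring
  have sym_1_011 : S 1 0 1 1 = -(P.1 0 * P.2 1 - 1) / (1 + P.1 0 * P.2 1) ^ 4 / 3 := by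
    simp [S, sym3, curv_webMap hD]
    ring
  obtain ⟨h0, h1⟩ : S 0 0 0 0 = 3 * S 1 0 0 1 ∧ S 0 0 0 1 = S 1 0 1 1 := hC.sym3_curv_eq
  have hy : P.2 1 = 0 := by simpa [sym_0_000, sym_1_001, hD] using h0.symm
  norm_num [sym_0_001, sym_1_011, hy] at h1

theorem contDiffAt_neg_log_one_add_mul {P : Space} (hD : 1 + P.1 0 * P.2 1 ≠ 0)
    {n : WithTop ℕ∞} : ContDiffAt ℝ n (fun Q : Space => -Real.log (1 + Q.1 0 * Q.2 1)) P :=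
  (((contDiff_const.add ((dx 0).contDiff.mul (dy 1).contDiff)).contDiffAt).log hD).neg

theorem hasFDerivAt_neg_log_thetaForm_webMap {P : Space} (hD : 1 + P.1 0 * P.2 1 ≠ 0) :
    HasFDerivAt (fun Q : Space => -Real.log (1 + Q.1 0 * Q.2 1)) (thetaForm webMap P) P := by
  refine ((hasFDerivAt_one_add_mul P).log hD).fun_neg.congr_fderiv
    (ContinuousLinearMap.ext fun v => ?_)
  simp [thetaForm, covec_webMap, om1_webMap_zero, om2_webMap_one]
  field_simp
  ring

theorem extD_thetaForm_webMap {P : Space} (hD : 1 + P.1 0 * P.2 1 ≠ 0) (u v : Space) :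
    extD (thetaForm webMap) P u v = 0 := by
  have thetaForm_eq : thetaForm webMap =ᶠ[𝓝 P]
      fderiv ℝ fun Q : Space => -Real.log (1 + Q.1 0 * Q.2 1) :=
    ((hasFDerivAt_one_add_mul P).continuousAt.eventually_ne hD).mono fun Q hQ =>
      (hasFDerivAt_neg_log_thetaForm_webMap hQ).fderiv.symm
  calc extD (thetaForm webMap) P u v
      = extDeriv₁ (fderiv ℝ fun Q : Space => -Real.log (1 + Q.1 0 * Q.2 1)) P u v :=
        congrFun₂ (extDeriv₁_congr thetaForm_eq) u v
    _ = 0 := extDeriv₁_fderiv (contDiffAt_neg_log_one_add_mul hD) u v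

theorem isIntegrable_thetaDist_webMap {U : Set Space} (hU : IsOpen U)
    (hD : ∀ P ∈ U, 1 + P.1 0 * P.2 1 ≠ 0) (ha : ∀ P ∈ U, ∃ i, covec webMap i P ≠ 0) :
    IsIntegrable 3 (thetaDist webMap) U := by
  refine isIntegrable_ker_of_hasFDerivAt hU
    (fun P hP => (contDiffAt_neg_log_one_add_mul (hD P hP)).contDiffWithinAt)
    (fun P hP => hasFDerivAt_neg_log_thetaForm_webMap (hD P hP)) fun P hP h0 => ?_
  have h := isWebAt_webMap (hD P hP)
  have covec_zero : covec webMap 0 P = 0 := by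
    simpa [thetaForm, h.om1_vec1] using DFunLike.congr_fun h0 (vec1 webMap (Pi.single 0 1) P)
  have covec_one : covec webMap 1 P = 0 := by
    simpa [thetaForm, h.om2_vec2] using DFunLike.congr_fun h0 (vec2 webMap (Pi.single 1 1) P)
  obtain ⟨i, hi⟩ := ha P hP
  fin_cases i
  · exact hi covec_zero
  · exact hi covec_one

end WebMap

end ThreeWeb

theorem mainTheorem9 :
    Dense {P : Space | 1 + P.1 0 * P.2 1 ≠ 0 ∧ P.1 0 * P.2 1 ≠ 1 ∧
      P.1 0 ≠ 0 ∧ P.2 1 ≠ 0 ∧ P.1 0 ≠ -P.2 1} ∧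
    ∀ U : Set Space, IsOpen U → U.Nonempty → (∀ P ∈ U, 1 + P.1 0 * P.2 1 ≠ 0) →
      IsThreeWeb webMap U ∧
      -- the distribution `a₁ ω₁¹ - a₂ ω₂² = 0`
      ((∀ P ∈ U, ∃ i, covec webMap i P ≠ 0) →
        ((∀ P ∈ U, pT webMap 1 0 P = -qT webMap 0 1 P) ↔
          IsIntegrable 3 (thetaDist webMap) U)) ∧
      (∀ P ∈ U, ∀ u v : Space,
        extD (thetaForm webMap) P u v =
          wedge (nablaA webMap 0 P) (om1 webMap 0 P) u v -
            wedge (nablaA webMap 1 P) (om2 webMap 1 P) u v) ∧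
      (∀ P ∈ U,
        (wedge (nablaA webMap 0 P) (om1 webMap 0 P) = wedge (nablaA webMap 1 P) (om2 webMap 1 P) ↔
          pT webMap 1 0 P = -qT webMap 0 1 P)) ∧
      -- the distributions `ω₁ⁱ + ω₂ⁱ = 0`
      (∀ i, IsIntegrable 3 (sumDist webMap i) U) ∧
      -- the classes
      (∀ P ∈ U, pAlt webMap P = qAlt webMap P ∧
        (∀ i, pT webMap i 1 P = 0 ∧ qT webMap i 0 P = 0) ∧
        pT webMap 1 0 P = -qT webMap 0 1 P) ∧
      (InClassG3 webMap U ↔ ∀ P ∈ U, P.1 0 * P.2 1 ≠ 1) ∧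
      (InClassE111 webMap U ↔ ∀ P ∈ U, P.1 0 ≠ 0 ∧ P.2 1 ≠ 0 ∧ P.1 0 ≠ -P.2 1) ∧
      InClassB webMap U ∧
      InClassC webMap U := by
  refine ⟨dense_setOf_generic, fun U hU hne hD => ?_⟩
  obtain ⟨P, ⟨-, -, hx, hy, -⟩, hP⟩ := dense_setOf_generic.exists_mem_open hU hne
  have hw := isThreeWeb_webMap hU hD
  have hpq (Q) (hQ : Q ∈ U) := pT_one_eq_zero_and_qT_zero_eq_zero_webMap (hD Q hQ)
  have hsymm (Q) (hQ : Q ∈ U) := pT_eq_neg_qT_webMap (hD Q hQ)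
  have wedge_iff (Q) (hQ : Q ∈ U) := (hw.isWebAt hQ).wedge_nablaA_eq_iff (hpq Q hQ)
  refine ⟨hw, fun ha => iff_of_true hsymm (isIntegrable_thetaDist_webMap hU hD ha),
    fun Q hQ u v => ?_, wedge_iff, hw.isIntegrable_sumDist,
    fun Q hQ => ⟨pAlt_eq_qAlt_webMap (hD Q hQ), hpq Q hQ, hsymm Q hQ⟩,
    inClassG3_webMap_iff hD, inClassE111_webMap_iff hD,
    hw.inClassB hP (not_transversalCondition_webMap (hD P hP) hx hy),
    hw.inClassC hP (not_curvatureCondition_webMap (hD P hP))⟩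
  rw [extD_thetaForm_webMap (hD Q hQ), (wedge_iff Q hQ).2 (hsymm Q hQ), sub_self]
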